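/- Consider the honeycomb lattice of regular hexagonal cells with two horizontal sides. A polyomino is a finite nonempty set of cells that is connected (through common sides), taken up to translation; it is convex if its intersection with every line through the centre of a cell in one of the three directions $\pi/6$, $\pi/2$, $5\pi/6$ is connected. Its area is its number of cells and its half perimeter is half of the number of unit segments on its boundary. Let $\mathrm r$ be the rotation by $\pi/3$, $\mathrm v$ the reflection in a vertical axis, and let $\mathrm{Fix}(H_{3,1})$ be the set of convex polyominoes that are invariant, up to translation, under $H_{3,1}=\langle \mathrm r^2,\mathrm v\rangle$, with generating series $|\mathrm{Fix}(H_{3,1})|_{q,t}$ in which $q$ marks the area and $t$ the half perimeter (there are finitely many convex polyominoes of given area up to translation). A directed convex polyomino is a convex polyomino with a diagonal basis (consecutive cells $b_1,\dots,b_r$, each the north-east neighbour of the preceding one) such that every cell is reached from a basis cell by north steps inside the polyomino; it has $r$ columns. Passing from a column to the next one, its upper profile has a weak decrease if its level falls by exactly half a hexagon and a strong decrease if it falls by more. The last column is in state $2$ if some strong decrease occurs, otherwise in state $1$ if some weak decrease occurs, and otherwise in state $0$. Let $[x^r][v^n]\mathrm{DC}_i(x,q,v,t)$ be the series by area ($q$)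 and half perimeter ($t$) of the directed convex polyominoes with $r$ columns whose last column has size $n$ and is in state $i$, and put $$\mathrm{DC}_{i,r,n}(q,t)=\frac1{t^{2r+n-1}}[x^r][v^n]\mathrm{DC}_i(x,q,v,t).$$ Let $\mathrm{TO}_0(x,q)=1$, $\mathrm{TO}_1(x,q)=1+xq$ and $\mathrm{TO}_n(x,q)=(2+xq^n)\mathrm{TO}_{n-1}(x,q)-\mathrm{TO}_{n-2}(x,q)$ for $n\ge2$. Put $$\mathcal R_1(q,t)=\sum_{h\ge1}t^{3(2h-1)}q^{3h(h-1)+1}\sum_{l\ge1}\sum_{r=1}^{h}\frac1{q^{3l}}\bigl(\mathrm{DC}_{0,r,l}(q^6,t^6)+\mathrm{DC}_{1,r,l}(q^6,t^6)\bigr),$$ $$\mathcal R_3(q,t)=\sum_{h\ge1}t^{3(2h-1)}q^{3h(h-1)+1}\,\mathrm{TO}_{h-1}(t^6,q^6).$$ For $i\in\{0,1\}$ and $r,l\ge 1$ the quotients by monomials above are genuine power series, and the sums converge coefficientwise. Then every convex polyomino $P$ invariant under $H_{3,1}$ has exactly one cell $c\in P$ such that $P$ is invariant under the rotation by $2\pi/3$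 about the centre of $c$ and under the reflection in the vertical axis through the centre of $c$. Let $h_1$ and $h_2$ be the numbers of cells of $P$ on the rays issued from $c$ (included) towards the north and towards the north-east, respectively. The series by area and half perimeter of the elements of $\mathrm{Fix}(H_{3,1})$ with $h_1>h_2$ is $\mathcal R_1$, of those with $h_1<h_2$ also $\mathcal R_1$, of those with $h_1=h_2$ it is $\mathcal R_3$, and therefore $$|\mathrm{Fix}(H_{3,1})|_{q,t}=2\mathcal R_1(q,t)+\mathcal R_3(q,t).$$ -/

import Mathlib

/-! ## The honeycomb lattice

Cells are regular hexagons with two horizontal sides. The cell `(a, b)` is the cell reached from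
a fixed cell by `a` steps to the north-east and `b` steps to the north. -/

/-- Cells of the honeycomb lattice, in axial coordinates. -/
abbrev Cell : Type := ℤ × ℤ

/-- One step to the north (angle `π/2`). -/
def north : Cell := (0, 1)

/-- One step to the north-east (angle `π/6`). -/
def northEast : Cell := (1, 0)

/-- One step to the north-west (angle `5π/6`). -/
def northWest : Cell := (-1, 1)

/-- The steps from a cell to the six cells sharing a side with it. -/
def hexSteps : Finset Cell :=
  {north, northEast, northWest, -north, -northEast, -northWest}

theorem neg_mem_hexSteps {d : Cell} (hd : d ∈ hexSteps) : -d ∈ hexSteps := by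
  simp only [hexSteps, Finset.mem_insert, Finset.mem_singleton] at hd ⊢
  rcases hd with h | h | h | h | h | h <;> subst h <;> simp

/-- Two cells are adjacent when they share a side. -/
def hexGraph : SimpleGraph Cell where
  Adj c d := d - c ∈ hexSteps
  symm := ⟨fun c d h => by simpa using neg_mem_hexSteps h⟩
  loopless := ⟨fun c h => by
    rw [sub_self] at h
    exact absurd h (by decide)⟩

/-! ## Convex polyominoes -/

/-- A polyomino is a finite (nonempty) connected set of cells. -/
def IsPolyomino (P : Finset Cell) : Prop :=
  (hexGraph.induce (P : Set Cell)).Connected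

/-- Each line of direction `d` through the centre of a cell meets `P` in a connected set. -/
def IsConvexAlong (d : Cell) (P : Finset Cell) : Prop :=
  ∀ c ∈ P, ∀ n : ℕ, c + n • d ∈ P → ∀ k ≤ n, c + k • d ∈ P

/-- Convex polyominoes: convexity along the three column directions `π/6`, `π/2`, `5π/6`. -/
def IsConvexPolyomino (P : Finset Cell) : Prop :=
  IsPolyomino P ∧ IsConvexAlong north P ∧ IsConvexAlong northEast P ∧ IsConvexAlong northWest P

/-- Number of unit segments on the boundary: sides of a cell of `P` behind which there is no cell
of `P`. -/
def perimeter (P : Finset Cell) : ℕ :=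
  ∑ c ∈ P, (hexSteps.filter fun d => c + d ∉ P).card

theorem even_perimeter (P : Finset Cell) : Even (perimeter P) := by
  classical
  have h1 : perimeter P + ∑ c ∈ P, (hexSteps.filter fun d => c + d ∈ P).card = 6 * P.card := by
    rw [perimeter, ← Finset.sum_add_distrib, mul_comm, ← smul_eq_mul, ← Finset.sum_const]
    refine Finset.sum_congr rfl fun c _ => ?_
    rw [add_comm, Finset.card_filter_add_card_filter_not]
    rfl
  have h2 : Even (∑ c ∈ P, (hexSteps.filter fun d => c + d ∈ P).card) := by
    have h3 : ∀ c ∈ P, (hexSteps.filter fun d => c + d ∈ P).card =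
        (({north, northEast, northWest} : Finset Cell).filter fun d => c + d ∈ P).card +
        (({north, northEast, northWest} : Finset Cell).filter fun d => c - d ∈ P).card := by
      intro c _
      simp only [Finset.card_filter]
      have e : hexSteps = ({north, northEast, northWest} : Finset Cell) ∪
          ({-north, -northEast, -northWest} : Finset Cell) := by decide
      rw [e, Finset.sum_union (by decide)]
      congr 1
    rw [Finset.sum_congr rfl h3, Finset.sum_add_distrib]
    simp only [Finset.card_filter]
    rw [Finset.sum_comm, Finset.sum_comm (s := P) (t := {north, northEast, northWest}),
      ← Finset.sum_add_distrib]
    refine Finset.even_sum _ fun d _ => ?_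
    rw [← Finset.card_filter, ← Finset.card_filter]
    have : (P.filter fun c => c + d ∈ P).card = (P.filter fun c => c - d ∈ P).card := by
      refine Finset.card_bij (fun c _ => c + d) ?_ ?_ ?_
      · intro c hc
        simp only [Finset.mem_filter] at hc ⊢
        simpa using ⟨hc.2, hc.1⟩
      · intro a _ b _ h
        simpa using h
      · intro b hb
        simp only [Finset.mem_filter] at hb
        exact ⟨b - d, by simpa using ⟨hb.2, hb.1⟩, by simp⟩
    rw [this]
    exact ⟨_, rfl⟩
  have h4 : Even (6 * P.card) := ⟨3 * P.card, by ring⟩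
  rw [← h1] at h4
  exact (Nat.even_add.mp h4).mpr h2

/-- Half of the perimeter, which is an even number. -/
def halfPerimeter (P : Finset Cell) : ℕ := perimeter P / 2

/-! ## Sets of cells up to translation, and the action of the dihedral group -/

/-- The translate of `P` by `u`. -/
def shift (u : Cell) (P : Finset Cell) : Finset Cell := P.map (addRightEmbedding u)

theorem mem_shift {u c : Cell} {P : Finset Cell} : c ∈ shift u P ↔ c - u ∈ P := by
  simp only [shift, Finset.mem_map, addRightEmbedding_apply]
  constructor
  · rintro ⟨a, ha, rfl⟩
    simpa using ha
  · intro h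
    exact ⟨_, h, by simp⟩

/-- Additive automorphisms of the lattice of cells; the product is composition. -/
abbrev LatticeAut : Type := Cell ≃ₗ[ℤ] Cell

/-- The image of `P` under an additive automorphism of the lattice. -/
def transform (g : LatticeAut) (P : Finset Cell) : Finset Cell := P.map g.toEquiv.toEmbedding

theorem mem_transform {g : LatticeAut} {c : Cell} {P : Finset Cell} :
    c ∈ transform g P ↔ g.symm c ∈ P := by
  simp only [transform, Finset.mem_map_equiv]
  rfl

/-- Equality up to translation. -/
def translationSetoid : Setoid (Finset Cell) where
  r P Q := ∃ u, Q = shift u P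
  iseqv :=
    { refl := fun P => ⟨0, by ext c; simp [mem_shift]⟩
      symm := by
        rintro P Q ⟨u, rfl⟩
        exact ⟨-u, by ext c; simp [mem_shift]⟩
      trans := by
        rintro P Q R ⟨u, rfl⟩ ⟨w, rfl⟩
        exact ⟨u + w, by ext c; simp [mem_shift, sub_sub, add_comm]⟩ }

/-- Finite sets of cells up to translation. -/
def TransClass : Type := Quotient translationSetoid

namespace TransClass

/-- The class of a finite set of cells. -/
def mk (P : Finset Cell) : TransClass := Quotient.mk translationSetoid P

/-- Number of cells. -/
def area : TransClass → ℕ :=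
  Quotient.lift Finset.card (by
    rintro P Q ⟨u, rfl⟩
    simp [shift])

/-- Half of the number of boundary segments. -/
def halfPerim : TransClass → ℕ :=
  Quotient.lift halfPerimeter (by
    rintro P Q ⟨u, rfl⟩
    simp only [halfPerimeter, perimeter]
    congr 1
    have h : ∀ f : Cell → ℕ, ∑ c ∈ shift u P, f c = ∑ c ∈ P, f (c + u) := fun f => by
      simp [shift]
    rw [h]
    refine Finset.sum_congr rfl fun c _ => ?_
    congr 1
    refine Finset.filter_congr fun d _ => ?_
    rw [mem_shift, add_right_comm, add_sub_cancel_right])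

/-- Action of a lattice automorphism on sets of cells up to translation. -/
def act (g : LatticeAut) : TransClass → TransClass :=
  Quotient.map (transform g) (by
    rintro P Q ⟨u, rfl⟩
    exact ⟨g u, by ext c; simp [mem_shift, mem_transform]⟩)

end TransClass

/-- The clockwise rotation by `π/3` about the cell `(0, 0)`. It sends north to north-east and
north-east to south-east. -/
def rot : LatticeAut where
  toFun c := (c.1 + c.2, -c.1)
  invFun c := (-c.2, c.1 + c.2)
  left_inv c := by ext <;> simp
  right_inv c := by ext <;> simp
  map_add' c d := by
    ext
    · simp; ring
    · simp; ring
  map_smul' n c := by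
    ext
    · simp [mul_add]
    · simp [mul_add]

/-- The reflection in the vertical axis through the centre of the cell `(0, 0)`. It fixes north and
exchanges north-east and north-west. -/
def vert : LatticeAut where
  toFun c := (-c.1, c.1 + c.2)
  invFun c := (-c.1, c.1 + c.2)
  left_inv c := by ext <;> simp
  right_inv c := by ext <;> simp
  map_add' c d := by
    ext
    · simp; ring
    · simp; ring
  map_smul' n c := by
    ext
    · simp [mul_add]
    · simp [mul_add]

/-- The group `H_{3,1} = ⟨r², v⟩`. -/
def groupH31 : Subgroup (LatticeAut) := Subgroup.closure {rot ^ 2, vert}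

/-- Convex polyominoes, up to translation. -/
def convexClasses : Set TransClass := {s | ∃ P, IsConvexPolyomino P ∧ TransClass.mk P = s}

/-- `Fix(H)`: convex polyominoes, up to translation, that are fixed by each element of `H`. -/
def fixClasses (H : Subgroup (LatticeAut)) : Set TransClass :=
  {s ∈ convexClasses | ∀ g ∈ H, TransClass.act g s = s}

/-- The number of cells of `P` on the ray of direction `d` issued from the cell `(0, 0)`, this cell
included. -/
noncomputable def extent (d : Cell) (P : Finset Cell) : ℕ :=
  {c : Cell | c ∈ P ∧ ∃ k : ℕ, c = k • d}.ncard

/-- The elements of `Fix(H_{3,1})` whose representative `P` with symmetry centre `(0, 0)` has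
extents `h₁` (north) and `h₂` (north-east) satisfying `rel h₁ h₂`. -/
def fixH31Subclass (rel : ℕ → ℕ → Prop) : Set TransClass :=
  {s ∈ fixClasses groupH31 | ∃ P, TransClass.mk P = s ∧ (∀ g ∈ groupH31, transform g P = P) ∧
    rel (extent north P) (extent northEast P)}

/-! ## Generating series -/

/-- Formal power series with integer coefficients in the two variables `q` and `t`. -/
abbrev QTSeries : Type := MvPowerSeries (Fin 2) ℤ

/-- The variable `q`, marking the area. -/
noncomputable def qVar : QTSeries := MvPowerSeries.X 0

/-- The variable `t`, marking the half perimeter. -/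
noncomputable def tVar : QTSeries := MvPowerSeries.X 1

/-- The series `∑_{s ∈ S} q^{area s} t^{hp s}`. -/
noncomputable def genSeries {α : Type} (S : Set α) (area hp : α → ℕ) : QTSeries :=
  fun e => ({s ∈ S | area s = e 0 ∧ hp s = e 1}.ncard : ℤ)

/-- The series `q^{-a} t^{-b} F`, for `F` divisible by `q^a t^b`. -/
noncomputable def divMonomial (a b : ℕ) (F : QTSeries) : QTSeries :=
  fun e => MvPowerSeries.coeff (e + Finsupp.single 0 a + Finsupp.single 1 b) F

theorem mul_divMonomial {a b : ℕ} {F : QTSeries} (h : qVar ^ a * tVar ^ b ∣ F) :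
    qVar ^ a * tVar ^ b * divMonomial a b F = F := by
  obtain ⟨G, rfl⟩ := h
  refine congrArg (qVar ^ a * tVar ^ b * ·) ?_
  refine MvPowerSeries.ext (R := ℤ) (φ := divMonomial a b (qVar ^ a * tVar ^ b * G)) (ψ := G)
    fun e => ?_
  change MvPowerSeries.coeff (e + Finsupp.single 0 a + Finsupp.single 1 b)
    (qVar ^ a * tVar ^ b * G : MvPowerSeries (Fin 2) ℤ) = MvPowerSeries.coeff e G
  rw [qVar, tVar, MvPowerSeries.X_pow_eq, MvPowerSeries.X_pow_eq,
    MvPowerSeries.monomial_mul_monomial, add_assoc, add_comm e,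
    MvPowerSeries.coeff_add_monomial_mul, one_mul, one_mul]

/-- The series `F(q^6, t^6)`. -/
noncomputable def atSixthPowers (F : QTSeries) : QTSeries :=
  MvPowerSeries.expand 6 (by norm_num) F

/-! ## Directed convex polyominoes -/

/-- Directed (towards north) convex polyominoes with `r` columns, whose diagonal basis consists of
the cells `(0, 0), (1, 0), …, (r - 1, 0)`: each cell is reached from a basis cell by north steps
inside the polyomino. Fixing the position of the basis selects one representative up to
translation. -/
def IsDirectedConvex (r : ℕ) (D : Finset Cell) : Prop :=
  IsConvexPolyomino D ∧ (∀ i < r, i • northEast ∈ D) ∧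
    ∀ c ∈ D, ∃ i < r, ∃ k : ℕ, c = i • northEast + k • north ∧
      ∀ j ≤ k, i • northEast + j • north ∈ D

/-- The size of column number `i`. -/
def colSize (D : Finset Cell) (i : ℕ) : ℕ := (D.filter fun c => c.1 = (i : ℤ)).card

/-- The level of the top of column number `i`, in half hexagons; the basis rises by one half
hexagon at each column. -/
def level (D : Finset Cell) (i : ℕ) : ℤ := 2 * colSize D i + i

/-- From column `i` to the next one, the upper profile falls by one half hexagon. -/
def WeakDecrease (D : Finset Cell) (i : ℕ) : Prop := level D (i + 1) - level D i = -1

/-- From column `i` to the next one, the upper profile falls by more than one half hexagon. -/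
def StrongDecrease (D : Finset Cell) (i : ℕ) : Prop := level D (i + 1) - level D i < -1

open Classical in
/-- The state of the last one of the `r` columns: a first weak decrease leads from state `0` to
state `1`, and a strong decrease leads from state `0` or `1` to state `2`. -/
noncomputable def lastState (r : ℕ) (D : Finset Cell) : ℕ :=
  if ∃ i, i + 1 < r ∧ StrongDecrease D i then 2
  else if ∃ i, i + 1 < r ∧ WeakDecrease D i then 1
  else 0

/-- Directed convex polyominoes with `r` columns, the last one being of size `n` and in state
`i`. -/
def directedConvex (i r n : ℕ) : Set (Finset Cell) :=
  {D | IsDirectedConvex r D ∧ colSize D (r - 1) = n ∧ lastState r D = i}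

/-- There are finitely many directed convex polyominoes with `r` columns and given area. -/
theorem finite_isDirectedConvex (r m : ℕ) :
    {D : Finset Cell | IsDirectedConvex r D ∧ D.card = m}.Finite := by
  refine Set.Finite.subset
    (Finset.finite_toSet ((Finset.Icc (0 : ℤ) r ×ˢ Finset.Icc (0 : ℤ) m).powerset)) ?_
  rintro D ⟨⟨-, -, h⟩, rfl⟩
  simp only [Finset.coe_powerset, Set.mem_preimage, Set.mem_powerset_iff, Finset.coe_subset]
  intro c hc
  obtain ⟨i, hi, k, rfl, hk⟩ := h c hc
  have hcard : k + 1 ≤ D.card := by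
    have := Finset.card_le_card_of_injOn (s := Finset.range (k + 1)) (t := D)
      (fun j : ℕ => i • northEast + j • north)
      (fun j hj => hk j (Nat.lt_succ_iff.mp (by simpa using hj)))
      (fun a _ b _ hab => by simpa [north] using hab)
    simpa using this
  simp only [north, northEast, Finset.mem_product, Finset.mem_Icc]
  simp
  omega

/-- The series `[x^r] [v^n] DC_i(x, q, v, t)`. -/
noncomputable def seriesDC (i r n : ℕ) : QTSeries :=
  genSeries (directedConvex i r n) Finset.card halfPerimeter

/-- The series `DC_{i,r,n}(q, t) = t^{-(2 r + n - 1)} [x^r] [v^n] DC_i(x, q, v, t)`. -/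
noncomputable def normSeriesDC (i r n : ℕ) : QTSeries :=
  divMonomial 0 (2 * r + n - 1) (seriesDC i r n)

/-! ## The series of the result -/

/-- The stack polynomials `TO_n(x, q)`. -/
def stackTO {R : Type*} [CommRing R] (x q : R) : ℕ → R
  | 0 => 1
  | 1 => 1 + x * q
  | n + 2 => (2 + x * q ^ (n + 2)) * stackTO x q (n + 1) - stackTO x q n

/-- The weight of the super-hexagon of radius `h`. -/
noncomputable def superHexagon (h : ℕ) : QTSeries :=
  tVar ^ (3 * (2 * h - 1)) * qVar ^ (3 * h * (h - 1) + 1)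

/-- The series `DC_{0,r,l}(q^6, t^6) + DC_{1,r,l}(q^6, t^6)`. -/
noncomputable def seriesDC01 (r l : ℕ) : QTSeries :=
  atSixthPowers (normSeriesDC 0 r l) + atSixthPowers (normSeriesDC 1 r l)

/-- The term of index `(h, l)` of the series `R₁`. -/
noncomputable def termR1 (h l : ℕ) : QTSeries :=
  superHexagon h * ∑ r ∈ Finset.Icc 1 h, divMonomial (3 * l) 0 (seriesDC01 r l)

/-- The term of index `h` of the series `R₃`. -/
noncomputable def termR3 (h : ℕ) : QTSeries :=
  superHexagon h * stackTO (tVar ^ 6) (qVar ^ 6) (h - 1)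

open scoped MvPowerSeries.WithPiTopology in
/-- The series `R₁`, a sum over `h ≥ 1` and `l ≥ 1` that converges coefficientwise. -/
noncomputable def seriesR1 : QTSeries := ∑' h : ℕ+, ∑' l : ℕ+, termR1 h l

open scoped MvPowerSeries.WithPiTopology in
/-- The series `R₃`, a sum over `h ≥ 1` that converges coefficientwise. -/
noncomputable def seriesR3 : QTSeries := ∑' h : ℕ+, termR3 h

/-! After recentring, an element of `Fix(H_{3,1})` is invariant under a dihedral group of order 6
fixing the cell (0, 0), whose three reflection axes contain the directions north, south-east and
south-west. The sector of angle π/3 between north-west and north is a fundamental domain. The centre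
is the centroid: invariance up to translation under `rot ^ 2` and `vert` makes the sum of the cells
divisible by the area (`exists_isSymmetricConvex_shift`), and connectedness with convexity puts the
centre in the polyomino (`IsSymmetricConvex.zero_mem`).

Put h = h₂ and suppose h₁ ≥ h₂. Convexity forces the polyomino to contain every cell at distance
less than h from the centre, the super-hexagon of radius h. In the fundamental sector the rest
consists of piles of n k cells above the top side of the super-hexagon, k < h being the distance to
the north axis. Convexity amounts to n being unimodal with n (k + 1) ≤ n k + 1, and n 0 = h₁ - h₂
(`IsProfile.isSymmetricConvex`, `IsSymmetricConvex.exists_profile`). There are six copies of each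
pile except the one on the axis, which has three, so the area is 3h(h - 1) + 1 + 6 ∑ n k - 3 n 0.
Counting the lines of cells that are met gives the half perimeter 3(2h - 1) + 6 max n.

If n 0 = l > 0, the nonzero values of n fill an initial segment of length r ≤ h. Read backwards they
are the column sizes of a directed convex polyomino without strong decrease, that is, in state 0 or
1 (`bijOn_directedPolyomino`). Its half perimeter is max n + 2r + l - 1, which explains the
normalising power of t, while q^(-3l) corrects for the axis pile. If n 0 = 0, then n is a stack on h
- 1 cells, and inclusion-exclusion on the two end columns yields the recurrence of `stackTO`
(`stackSeries_succ_succ`). The reflection swapping north and north-east exchanges h₁ > h₂ with h₁ <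
h₂ (`bijOn_swapCells`). -/

/-! ### Generating series of sets with two statistics. -/

section GenSeries

variable {α β : Type}

theorem coeff_genSeries (S : Set α) (a b : α → ℕ) (e : Fin 2 →₀ ℕ) :
    MvPowerSeries.coeff e (genSeries S a b) = ({s ∈ S | a s = e 0 ∧ b s = e 1}.ncard : ℤ) :=
  rfl

theorem coeff_genSeries_eq_zero {S : Set α} {a b : α → ℕ} {e : Fin 2 →₀ ℕ}
    (h : ∀ s ∈ S, a s = e 0 → b s ≠ e 1) : MvPowerSeries.coeff e (genSeries S a b) = 0 := by
  have : {s ∈ S | a s = e 0 ∧ b s = e 1} = ∅ :=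
    Set.eq_empty_of_forall_notMem fun s hs => h s hs.1 hs.2.1 hs.2.2
  rw [coeff_genSeries, this]
  simp

theorem genSeries_congr {S : Set α} {a b a' b' : α → ℕ} (ha : ∀ s ∈ S, a s = a' s)
    (hb : ∀ s ∈ S, b s = b' s) : genSeries S a b = genSeries S a' b' := by
  refine MvPowerSeries.ext fun e => ?_
  simp only [coeff_genSeries]
  congr 2
  ext s
  simp only [Set.mem_ofPred_eq]
  constructor
  · rintro ⟨h, h1, h2⟩
    exact ⟨h, ha s h ▸ h1, hb s h ▸ h2⟩
  · rintro ⟨h, h1, h2⟩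
    exact ⟨h, (ha s h).trans h1, (hb s h).trans h2⟩

theorem genSeries_eq_of_bijOn {S : Set α} {T : Set β} {f : α → β} (hf : Set.BijOn f S T)
    (a b : β → ℕ) : genSeries T a b = genSeries S (fun s => a (f s)) (fun s => b (f s)) := by
  refine MvPowerSeries.ext fun e => ?_
  simp only [coeff_genSeries]
  congr 1
  symm
  refine Set.ncard_congr (fun s _ => f s) ?_ ?_ ?_
  · rintro s ⟨hs, h⟩
    exact ⟨hf.mapsTo hs, h⟩
  · rintro s s' ⟨hs, -⟩ ⟨hs', -⟩ h
    exact hf.injOn hs hs' h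
  · rintro t ⟨ht, h⟩
    obtain ⟨s, hs, rfl⟩ := hf.surjOn ht
    exact ⟨s, ⟨hs, h⟩, rfl⟩

theorem qVar_pow_mul_tVar_pow (A B : ℕ) : qVar ^ A * tVar ^ B =
    (MvPowerSeries.monomial (Finsupp.single 0 A + Finsupp.single 1 B) 1 : QTSeries) := by
  rw [qVar, tVar, MvPowerSeries.X_pow_eq, MvPowerSeries.X_pow_eq,
    MvPowerSeries.monomial_mul_monomial, one_mul]

theorem genSeries_add (S : Set α) (a b : α → ℕ) (A B : ℕ) :
    genSeries S (fun s => a s + A) (fun s => b s + B) =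
      qVar ^ A * tVar ^ B * genSeries S a b := by
  classical
  refine MvPowerSeries.ext fun e => ?_
  rw [qVar_pow_mul_tVar_pow, MvPowerSeries.coeff_monomial_mul]
  split_ifs with h
  · have h0 : A ≤ e 0 := by simpa using h 0
    have h1 : B ≤ e 1 := by simpa using h 1
    rw [one_mul, coeff_genSeries, coeff_genSeries]
    congr 2
    ext s
    refine and_congr_right fun _ => ?_
    simp
    omega
  · refine coeff_genSeries_eq_zero fun s _ h0 h1 => h fun i => ?_
    fin_cases i
    · simp; omega
    · simp; omega

theorem divMonomial_genSeries {S : Set α} {a b : α → ℕ} {A B : ℕ} (ha : ∀ s ∈ S, A ≤ a s)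
    (hb : ∀ s ∈ S, B ≤ b s) :
    divMonomial A B (genSeries S a b) = genSeries S (fun s => a s - A) (fun s => b s - B) := by
  refine MvPowerSeries.ext fun e => ?_
  change MvPowerSeries.coeff (e + Finsupp.single 0 A + Finsupp.single 1 B)
    (genSeries S a b) = _
  simp only [coeff_genSeries]
  congr 2
  ext s
  simp only [Set.mem_ofPred_eq, Finsupp.add_apply]
  refine and_congr_right fun hs => ?_
  have := ha s hs
  have := hb s hs
  simp
  omega

theorem dvd_genSeries {S : Set α} {a b : α → ℕ} {A B : ℕ} (ha : ∀ s ∈ S, A ≤ a s)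
    (hb : ∀ s ∈ S, B ≤ b s) : qVar ^ A * tVar ^ B ∣ genSeries S a b := by
  refine ⟨genSeries S (fun s => a s - A) (fun s => b s - B), ?_⟩
  rw [← genSeries_add]
  exact genSeries_congr (fun s hs => by have := ha s hs; omega)
    (fun s hs => by have := hb s hs; omega)

theorem atSixthPowers_genSeries (S : Set α) (a b : α → ℕ) :
    atSixthPowers (genSeries S a b) = genSeries S (fun s => 6 * a s) (fun s => 6 * b s) := by
  refine MvPowerSeries.ext fun e => ?_
  rw [atSixthPowers]
  by_cases h : ∀ i, 6 ∣ e i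
  · obtain ⟨e', rfl⟩ : ∃ e' : Fin 2 →₀ ℕ, e = 6 • e' := by
      refine ⟨e.mapRange (· / 6) rfl, ?_⟩
      ext i
      have := h i
      simp
      omega
    rw [MvPowerSeries.coeff_expand_smul]
    simp only [coeff_genSeries]
    congr 2
    ext s
    simp
  · push Not at h
    obtain ⟨i, hi⟩ := h
    rw [MvPowerSeries.coeff_expand_of_not_dvd 6 (by norm_num) _ hi]
    symm
    refine coeff_genSeries_eq_zero fun s _ h0 h1 => hi ?_
    fin_cases i
    · exact ⟨_, h0.symm⟩
    · exact ⟨_, h1.symm⟩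

/-- Finiteness matters: `ncard` is 0 on infinite sets, which would break additivity. -/
theorem genSeries_union_add_inter {S T : Set α} (a b : α → ℕ) (hS : S.Finite) (hT : T.Finite) :
    genSeries (S ∪ T) a b + genSeries (S ∩ T) a b = genSeries S a b + genSeries T a b := by
  refine MvPowerSeries.ext fun e => ?_
  simp only [map_add, coeff_genSeries]
  norm_cast
  rw [← Set.ncard_union_add_ncard_inter {s ∈ S | a s = e 0 ∧ b s = e 1}
    {s ∈ T | a s = e 0 ∧ b s = e 1} (hS.subset fun s hs => hs.1) (hT.subset fun s hs => hs.1)]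
  congr 2
  · ext s; simp only [Set.mem_ofPred_eq, Set.mem_union]; tauto
  · ext s; simp only [Set.mem_ofPred_eq, Set.mem_inter_iff]; tauto

theorem genSeries_singleton (s : α) (a b : α → ℕ) :
    genSeries {s} a b = qVar ^ a s * tVar ^ b s := by
  classical
  refine MvPowerSeries.ext fun e => ?_
  rw [qVar_pow_mul_tVar_pow, MvPowerSeries.coeff_monomial]
  split_ifs with h
  · subst h
    rw [coeff_genSeries]
    have : {x | x ∈ ({s} : Set α) ∧ a x = (Finsupp.single 0 (a s) + Finsupp.single 1 (b s) :
        Fin 2 →₀ ℕ) 0 ∧ b x = (Finsupp.single 0 (a s) + Finsupp.single 1 (b s) :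
        Fin 2 →₀ ℕ) 1} = {s} := by
      ext x
      simp
      rintro rfl
      simp
    rw [this]
    simp
  · refine coeff_genSeries_eq_zero fun x hx h0 h1 => h ?_
    obtain rfl := hx
    ext i
    fin_cases i <;> simp [h0, h1]

theorem genSeries_empty (a b : α → ℕ) : genSeries (∅ : Set α) a b = 0 := by
  refine MvPowerSeries.ext fun e => ?_
  rw [coeff_genSeries]
  simp

open scoped MvPowerSeries.WithPiTopology in
-- For a fixed exponent only finitely many elements of `S` contribute, and they lie in finitely many
-- of the disjoint blocks; so every coefficient is a finite sum.
theorem hasSum_genSeries {ι : Type} {S : Set α} {T : ι → Set α} (a b : α → ℕ)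
    (hS : ∀ m, {s ∈ S | a s = m}.Finite) (hST : S = ⋃ i, T i)
    (hT : Pairwise (Function.onFun Disjoint T)) :
    HasSum (fun i => genSeries (T i) a b) (genSeries S a b) := by
  classical
  rw [MvPowerSeries.WithPiTopology.hasSum_iff_hasSum_coeff]
  intro e
  simp only [coeff_genSeries]
  have hfin : {s ∈ S | a s = e 0 ∧ b s = e 1}.Finite :=
    (hS (e 0)).subset fun s hs => ⟨hs.1, hs.2.1⟩
  have hf : ∀ s ∈ S, ∃ i, s ∈ T i := fun s hs => by
    rw [hST] at hs
    simpa using hs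
  have huniq : ∀ s i j, s ∈ T i → s ∈ T j → i = j := fun s i j hi hj => by
    by_contra hij
    exact Set.disjoint_left.mp (hT hij) hi hj
  have hsub : ∀ i, T i ⊆ S := fun i => by
    rw [hST]
    exact Set.subset_iUnion T i
  -- A total choice of the block index needs `ι` inhabited; without blocks, `S` is empty.
  rcases isEmpty_or_nonempty ι with hι | ⟨⟨i0⟩⟩
  · have : S = ∅ := by rw [hST]; simp
    simp [this, hasSum_empty]
  have : Nonempty ι := ⟨i0⟩
  choose! f hf using hf
  let F := hfin.toFinset
  have key : (F.card : ℤ) = ∑ i ∈ F.image f, ({s ∈ T i | a s = e 0 ∧ b s = e 1}.ncard : ℤ) := by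
    rw [Finset.card_eq_sum_card_image f F]
    push_cast
    refine Finset.sum_congr rfl fun i _ => ?_
    rw [← Set.ncard_coe_finset]
    congr 2
    ext s
    simp only [Finset.coe_filter, Set.mem_ofPred_eq, F, Set.Finite.mem_toFinset]
    constructor
    · rintro ⟨⟨h1, h2⟩, rfl⟩
      exact ⟨hf s h1, h2⟩
    · rintro ⟨h1, h2⟩
      exact ⟨⟨hsub i h1, h2⟩, huniq s _ _ (hf s (hsub i h1)) h1⟩
  rw [Set.ncard_eq_toFinset_card _ hfin]
  rw [key]
  refine hasSum_sum_of_ne_finset_zero fun i hi => ?_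
  refine coeff_genSeries_eq_zero (S := T i) fun s hs h0 h1 => hi ?_
  rw [Finset.mem_image]
  exact ⟨s, hfin.mem_toFinset.mpr ⟨hsub i hs, h0, h1⟩, huniq s _ _ (hf s (hsub i hs)) hs⟩

theorem genSeries_biUnion {ι : Type} (I : Finset ι) {S : Set α} {T : ι → Set α} (a b : α → ℕ)
    (hS : S.Finite) (hST : S = ⋃ i ∈ I, T i)
    (hT : ∀ i j s, s ∈ T i → s ∈ T j → i = j) :
    genSeries S a b = ∑ i ∈ I, genSeries (T i) a b := by
  classical
  induction I using Finset.induction_on generalizing S with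
  | empty =>
    have : S = ∅ := by rw [hST]; simp
    rw [this, genSeries_empty, Finset.sum_empty]
  | insert i I hi ih =>
    have hS' : S = T i ∪ ⋃ j ∈ I, T j := by rw [hST, Finset.set_biUnion_insert]
    have h1 : (T i).Finite := hS.subset (by rw [hS']; exact Set.subset_union_left)
    have h2 : (⋃ j ∈ I, T j).Finite := hS.subset (by rw [hS']; exact Set.subset_union_right)
    have h3 : T i ∩ ⋃ j ∈ I, T j = ∅ := by
      ext s
      simp only [Set.mem_inter_iff, Set.mem_iUnion, Set.mem_empty_iff_false, iff_false]
      rintro ⟨hs, j, hj, hs'⟩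
      exact hi (hT i j s hs hs' ▸ hj)
    have := genSeries_union_add_inter a b h1 h2
    rw [h3, genSeries_empty, add_zero, ← hS'] at this
    rw [this, Finset.sum_insert hi, ih h2 rfl]

end GenSeries

/-! ### Connectedness, convexity and perimeter on the honeycomb lattice. -/

section Polyominoes

theorem mk_mem_hexSteps {x y : ℤ} : ((x, y) : Cell) ∈ hexSteps ↔
    (x = 0 ∧ y = 1) ∨ (x = 1 ∧ y = 0) ∨ (x = -1 ∧ y = 1) ∨ (x = 0 ∧ y = -1) ∨
      (x = -1 ∧ y = 0) ∨ (x = 1 ∧ y = -1) := by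
  simp [hexSteps, north, northEast, northWest]

/-- Used as a discrete crossing argument: if `S` holds at one cell and fails at another, some step
inside the polyomino leaves `S`. -/
theorem IsPolyomino.induction {P : Finset Cell} (hP : IsPolyomino P) {S : Cell → Prop} {c : Cell}
    (hc : c ∈ P) (hS : S c)
    (step : ∀ a ∈ P, ∀ b ∈ P, b - a ∈ hexSteps → S a → S b) {d : Cell} (hd : d ∈ P) : S d := by
  obtain ⟨w⟩ := hP.preconnected ⟨c, hc⟩ ⟨d, hd⟩
  have key : ∀ u v : (P : Set Cell), (hexGraph.induce (P : Set Cell)).Walk u v → S u → S v := by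
    intro u v w
    induction w with
    | nil => exact id
    | cons h _ ih => exact fun hu => ih (step _ (Subtype.property _) _ (Subtype.property _) h hu)
  exact key _ _ w hS

/-- Following strictly decreasing values of `μ` connects every cell to `c`. -/
theorem isPolyomino_of_descent {P : Finset Cell} {c : Cell} (hc : c ∈ P) (μ : Cell → ℕ)
    (h : ∀ a ∈ P, a ≠ c → ∃ b ∈ P, b - a ∈ hexSteps ∧ μ b < μ a) : IsPolyomino P := by
  have key : ∀ n, ∀ a (ha : a ∈ P), μ a = n →
      (hexGraph.induce (P : Set Cell)).Reachable ⟨a, ha⟩ ⟨c, hc⟩ := by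
    intro n
    induction n using Nat.strong_induction_on with
    | _ n ih =>
      intro a ha hn
      by_cases hac : a = c
      · subst hac
        exact SimpleGraph.Reachable.refl _
      · obtain ⟨b, hb, hab, hlt⟩ := h a ha hac
        refine SimpleGraph.Reachable.trans (SimpleGraph.Adj.reachable ?_) (ih _ (hn ▸ hlt) b hb rfl)
        exact hab
  have : Nonempty (P : Set Cell) := ⟨⟨c, hc⟩⟩
  exact ⟨fun a b => (key _ a.1 a.2 rfl).trans (key _ b.1 b.2 rfl).symm⟩

theorem IsConvexAlong.north_mem {P : Finset Cell} (h : IsConvexAlong north P) {x a b y : ℤ}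
    (ha : (x, a) ∈ P) (hb : (x, b) ∈ P) (h1 : a ≤ y) (h2 : y ≤ b) : (x, y) ∈ P := by
  have := h (x, a) ha (b - a).toNat (by
    convert hb using 1
    ext <;> simp [north]
    omega) (y - a).toNat (by omega)
  convert this using 1
  ext <;> simp [north]
  omega

theorem IsConvexAlong.northEast_mem {P : Finset Cell} (h : IsConvexAlong northEast P) {a b x y : ℤ}
    (ha : (a, y) ∈ P) (hb : (b, y) ∈ P) (h1 : a ≤ x) (h2 : x ≤ b) : (x, y) ∈ P := by
  have := h (a, y) ha (b - a).toNat (by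
    convert hb using 1
    ext <;> simp [northEast]
    omega) (x - a).toNat (by omega)
  convert this using 1
  ext <;> simp [northEast]
  omega

theorem IsConvexAlong.northWest_mem {P : Finset Cell} (h : IsConvexAlong northWest P)
    {x y a b s : ℤ} (ha : (a, s - a) ∈ P) (hb : (b, s - b) ∈ P) (h1 : a ≤ x) (h2 : x ≤ b)
    (hs : x + y = s) : (x, y) ∈ P := by
  subst hs
  have := h _ hb (b - a).toNat (by
    convert ha using 1
    ext
    · simp [northWest]; omega
    · simp [northWest]; omega) (b - x).toNat (by omega)
  convert this using 1
  ext
  · simp [northWest]; omega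
  · simp [northWest]; omega

theorem isConvexAlong_north {P : Finset Cell}
    (h : ∀ x a y b : ℤ, a ≤ y → y ≤ b → (x, a) ∈ P → (x, b) ∈ P → (x, y) ∈ P) :
    IsConvexAlong north P := by
  rintro ⟨x, a⟩ hc n hn k hk
  have e : ∀ m : ℕ, ((x, a) : Cell) + m • north = (x, a + m) := fun m => by
    ext <;> simp [north]
  rw [e] at hn ⊢
  exact h x a _ _ (by omega) (by omega) hc hn

theorem isConvexAlong_northEast {P : Finset Cell}
    (h : ∀ y a x b : ℤ, a ≤ x → x ≤ b → (a, y) ∈ P → (b, y) ∈ P → (x, y) ∈ P) :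
    IsConvexAlong northEast P := by
  rintro ⟨a, y⟩ hc n hn k hk
  have e : ∀ m : ℕ, ((a, y) : Cell) + m • northEast = (a + m, y) := fun m => by
    ext <;> simp [northEast]
  rw [e] at hn ⊢
  exact h y a _ _ (by omega) (by omega) hc hn

theorem isConvexAlong_northWest {P : Finset Cell}
    (h : ∀ s a x b : ℤ, a ≤ x → x ≤ b → (a, s - a) ∈ P → (b, s - b) ∈ P → (x, s - x) ∈ P) :
    IsConvexAlong northWest P := by
  rintro ⟨b, y⟩ hc n hn k hk
  have e : ∀ m : ℕ, ((b, y) : Cell) + m • northWest = (b - m, (b + y) - (b - m)) := fun m => by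
    ext <;> simp [northWest]; ring
  rw [e] at hn ⊢
  exact h (b + y) _ _ b (by omega) (by omega) hn (by simpa using hc)

theorem IsConvexAlong.neg {P : Finset Cell} {d : Cell} (h : IsConvexAlong d P) :
    IsConvexAlong (-d) P := by
  intro c hc n hn k hk
  have := h _ hn n (by simpa using hc) (n - k) (Nat.sub_le _ _)
  convert this using 1
  rw [Nat.cast_smul_eq_nsmul ℤ k (-d) |>.symm, Nat.cast_smul_eq_nsmul ℤ n (-d) |>.symm,
    Nat.cast_smul_eq_nsmul ℤ (n - k) d |>.symm, Nat.cast_sub hk, smul_neg, smul_neg, sub_smul]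
  abel

/-- A convex set has one last cell in direction `d` on each line of direction `d` that it meets. -/
theorem card_filter_add_notMem {P : Finset Cell} {d : Cell} (h : IsConvexAlong d P) {ℓ : Cell → ℤ}
    (hℓ : ∀ a b, ℓ a = ℓ b ↔ ∃ k : ℤ, b = a + k • d) (hd : d ≠ 0) :
    (P.filter fun c => c + d ∉ P).card = (P.image ℓ).card := by
  refine Finset.card_bij (fun c _ => ℓ c) ?_ ?_ ?_
  · intro c hc
    exact Finset.mem_image_of_mem _ (Finset.mem_filter.mp hc).1
  · have key : ∀ a b : Cell, a + d ∉ P → a ∈ P → b ∈ P → ∀ k : ℤ, 0 ≤ k → b = a + k • d → a = b := by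
      rintro a b ha ha' hb k hk rfl
      obtain ⟨m, rfl⟩ := Int.eq_ofNat_of_zero_le hk
      rcases m with _ | m
      · simp
      -- If `b` came after `a` on the line, convexity would put `a + d` in `P`.
      · have := h a ha' (m + 1) (by simpa using hb) 1 (by omega)
        rw [one_smul] at this
        exact absurd this ha
    intro a ha b hb hab
    rw [Finset.mem_filter] at ha hb
    obtain ⟨k, hk⟩ := (hℓ a b).mp hab
    rcases le_total 0 k with h0 | h0
    · exact key a b ha.2 ha.1 hb.1 k h0 hk
    · refine (key b a hb.2 hb.1 ha.1 (-k) (by omega) ?_).symm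
      rw [hk, neg_smul, add_neg_cancel_right]
  · intro l hl
    obtain ⟨c, hc, rfl⟩ := Finset.mem_image.mp hl
    -- Walking from `c` in direction `d` must leave the finite set `P`; the cell just before the
    -- first exit is the one sought.
    have hex : ∃ n : ℕ, c + n • d ∉ P := by
      by_contra! hcon
      refine Set.infinite_range_of_injective (f := fun n : ℕ => c + n • d) ?_
        (P.finite_toSet.subset ?_)
      · intro m n hmn
        have : m • d = n • d := by simpa using hmn
        have h' : (m : ℤ) • d = (n : ℤ) • d := by simpa using this
        exact_mod_cast smul_left_injective ℤ hd h'
      · rintro _ ⟨n, rfl⟩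
        exact hcon n
    classical
    have h1 := Nat.find_spec hex
    have h2 : Nat.find hex ≠ 0 := fun h0 => by
      rw [h0, zero_smul, add_zero] at h1
      exact h1 hc
    obtain ⟨m, hm⟩ := Nat.exists_eq_succ_of_ne_zero h2
    have h3 : c + m • d ∈ P := not_not.mp (Nat.find_min hex (by omega))
    refine ⟨c + m • d, Finset.mem_filter.mpr ⟨h3, ?_⟩, ?_⟩
    · rw [hm, succ_nsmul, ← add_assoc] at h1
      exact h1
    · exact ((hℓ _ _).mpr ⟨m, by simp⟩).symm

/-- The half perimeter of a convex set is the number of lines of cells that it meets. -/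
theorem halfPerimeter_eq_card_lines {P : Finset Cell} (h1 : IsConvexAlong north P)
    (h2 : IsConvexAlong northEast P) (h3 : IsConvexAlong northWest P) :
    halfPerimeter P = (P.image Prod.fst).card + (P.image Prod.snd).card +
      (P.image fun c => c.1 + c.2).card := by
  -- Boundary segments are sorted by outward direction. Each line met by `P` has one segment at each
  -- of its two ends, so the perimeter is twice the number of lines.
  have e : perimeter P = ∑ d ∈ hexSteps, (P.filter fun c => c + d ∉ P).card := by
    simp only [perimeter, Finset.card_filter]
    exact Finset.sum_comm
  have l1 : ∀ a b : Cell, a.1 = b.1 ↔ ∃ k : ℤ, b = a + k • north := by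
    rintro ⟨x, y⟩ ⟨x', y'⟩
    simp only [north, Prod.ext_iff]
    exact ⟨fun h => ⟨y' - y, by simpa using h.symm⟩, fun ⟨k, hk⟩ => by simpa using hk.1.symm⟩
  have l2 : ∀ a b : Cell, a.2 = b.2 ↔ ∃ k : ℤ, b = a + k • northEast := by
    rintro ⟨x, y⟩ ⟨x', y'⟩
    simp only [northEast, Prod.ext_iff]
    exact ⟨fun h => ⟨x' - x, by simpa using h.symm⟩, fun ⟨k, hk⟩ => by simpa using hk.2.symm⟩
  have l3 : ∀ a b : Cell, a.1 + a.2 = b.1 + b.2 ↔ ∃ k : ℤ, b = a + k • northWest := by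
    rintro ⟨x, y⟩ ⟨x', y'⟩
    simp only [northWest, Prod.ext_iff]
    refine ⟨fun h => ⟨x - x', ?_⟩, fun ⟨k, hk⟩ => ?_⟩
    · simp at h ⊢
      omega
    · simp at hk ⊢
      omega
  have neg : ∀ {ℓ : Cell → ℤ} {d : Cell}, (∀ a b, ℓ a = ℓ b ↔ ∃ k : ℤ, b = a + k • d) →
      ∀ a b, ℓ a = ℓ b ↔ ∃ k : ℤ, b = a + k • -d := fun h a b => by
    rw [h a b]
    exact ⟨fun ⟨k, hk⟩ => ⟨-k, by simpa using hk⟩, fun ⟨k, hk⟩ => ⟨-k, by simpa using hk⟩⟩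
  have e' : ∀ f : Cell → ℕ, ∑ d ∈ hexSteps, f d = f north + f northEast + f northWest +
      f (-north) + f (-northEast) + f (-northWest) := fun f => by
    simp only [hexSteps]
    repeat rw [Finset.sum_insert (by decide)]
    rw [Finset.sum_singleton]
    ring
  rw [halfPerimeter, e, e', card_filter_add_notMem h1 l1 (by decide),
    card_filter_add_notMem h2 l2 (by decide), card_filter_add_notMem h3 l3 (by decide),
    card_filter_add_notMem h1.neg (neg l1) (by decide),
    card_filter_add_notMem h2.neg (neg l2) (by decide),
    card_filter_add_notMem h3.neg (neg l3) (by decide)]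
  omega

/-- A polyomino lies within distance `area` of each of its cells. -/
theorem IsPolyomino.natAbs_sub_le {P : Finset Cell} (hP : IsPolyomino P) {c d : Cell} (hc : c ∈ P)
    (hd : d ∈ P) : (d.1 - c.1).natAbs ≤ P.card ∧ (d.2 - c.2).natAbs ≤ P.card := by
  classical
  obtain ⟨w, hw⟩ := (hP.preconnected ⟨c, hc⟩ ⟨d, hd⟩).exists_isPath
  have hlen : w.length < P.card := by
    have := hw.length_lt
    simpa using this
  have key : ∀ u v : (P : Set Cell), ∀ w : (hexGraph.induce (P : Set Cell)).Walk u v,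
      (v.1.1 - u.1.1).natAbs ≤ w.length ∧ (v.1.2 - u.1.2).natAbs ≤ w.length := by
    intro u v w
    induction w with
    | nil => simp
    | @cons u v t h _ ih =>
      have h' : ((v.1.1 - u.1.1, v.1.2 - u.1.2) : Cell) ∈ hexSteps := h
      rw [mk_mem_hexSteps] at h'
      rw [SimpleGraph.Walk.length_cons]
      omega
  have := key _ _ w
  simp only at this
  omega

/-- Translating a cell to (0, 0) brings a connected set of area `m` into a fixed box. -/
theorem finite_convexClasses_area (m : ℕ) : {s ∈ convexClasses | s.area = m}.Finite := by
  refine Set.Finite.subset (Set.Finite.image TransClass.mk (Finset.finite_toSet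
    ((Finset.Icc (-m : ℤ) m ×ˢ Finset.Icc (-m : ℤ) m).powerset))) ?_
  rintro s ⟨⟨P, hP, rfl⟩, hm⟩
  obtain ⟨⟨c, hc⟩⟩ := hP.1.nonempty
  refine ⟨shift (-c) P, ?_, ?_⟩
  · simp only [Finset.coe_powerset, Set.mem_preimage, Set.mem_powerset_iff, Finset.coe_subset]
    intro d hd
    rw [mem_shift] at hd
    have := hP.1.natAbs_sub_le hc hd
    have hm' : P.card = m := hm
    rw [hm'] at this
    simp at this
    simp only [Finset.mem_product, Finset.mem_Icc]
    omega
  · exact (Quotient.sound (s := translationSetoid) ⟨-c, rfl⟩).symm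

end Polyominoes

/-! ### From profiles to symmetric convex polyominoes. -/

section Sectors

/-- The convex polyominoes invariant under the rotation by `2π/3` about the cell `(0, 0)` and under
the reflection in the vertical axis through this cell. -/
structure IsSymmetricConvex (P : Finset Cell) : Prop where
  convex : IsConvexPolyomino P
  rot_mem : ∀ {x y : ℤ}, (x, y) ∈ P → (y, -x - y) ∈ P
  vert_mem : ∀ {x y : ℤ}, (x, y) ∈ P → (-x, x + y) ∈ P

/-- A property invariant under the group `H_{3,1}` holds everywhere if it holds in the sector
between the directions north-west and north. -/
theorem sector_induction {p : ℤ → ℤ → Prop} (hr : ∀ x y, p y (-x - y) → p x y)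
    (hv : ∀ x y, p (-x) (x + y) → p x y) (hs : ∀ x y, x ≤ 0 → 0 ≤ x + y → p x y) (x y : ℤ) :
    p x y := by
  have h1 : ∀ x y, x ≤ 0 → y ≤ 0 → p x y := fun x y hx hy =>
    hr _ _ (hs _ _ (by omega) (by omega))
  have h2 : ∀ x y, y ≤ 0 → 0 ≤ x + y → p x y := fun x y hx hy =>
    hr _ _ (h1 _ _ (by omega) (by omega))
  have h3 : ∀ x y, 0 ≤ x → 0 ≤ y → p x y := fun x y hx hy =>
    hv _ _ (hs _ _ (by omega) (by omega))
  have h4 : ∀ x y, 0 ≤ x → x + y ≤ 0 → p x y := fun x y hx hy =>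
    hv _ _ (h1 _ _ (by omega) (by omega))
  have h5 : ∀ x y, 0 ≤ y → x + y ≤ 0 → p x y := fun x y hx hy =>
    hv _ _ (h2 _ _ (by omega) (by omega))
  rcases le_total x 0 with hx | hx <;> rcases le_total y 0 with hy | hy <;>
    rcases le_total 0 (x + y) with hz | hz
  · exact hs _ _ hx hz
  · exact h1 _ _ hx hy
  · exact hs _ _ hx hz
  · exact h5 _ _ hy hz
  · exact h2 _ _ hy hz
  · exact h4 _ _ hx hz
  · exact h3 _ _ hx hy
  · exact h3 _ _ hx hy

/-- The distance of the cell `(x, y)` to the cell `(0, 0)`. -/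
def radius (x y : ℤ) : ℕ := max (max x.natAbs y.natAbs) (x + y).natAbs

/-- The distance of the cell `(x, y)` to the symmetry axis of the sector of angle `2π/3` to which
it belongs, along a line perpendicular to this axis counted in columns. -/
def offset (x y : ℤ) : ℕ :=
  if 0 ≤ y ∧ 0 ≤ x + y then x.natAbs
  else if x + y ≤ 0 ∧ x ≤ 0 then y.natAbs
  else (x + y).natAbs

theorem radius_rot (x y : ℤ) : radius y (-x - y) = radius x y := by
  unfold radius
  omega

theorem radius_vert (x y : ℤ) : radius (-x) (x + y) = radius x y := by
  unfold radius
  omega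

theorem offset_rot (x y : ℤ) : offset y (-x - y) = offset x y := by
  unfold offset
  split_ifs <;> omega

theorem offset_vert (x y : ℤ) : offset (-x) (x + y) = offset x y := by
  unfold offset
  split_ifs <;> omega

/-- The profiles of the parts outside the super-hexagon of radius `h`: `n k` is the number of
cells above the super-hexagon at distance `k` to the axis. -/
structure IsProfile (h : ℕ) (n : ℕ → ℕ) : Prop where
  step : ∀ k, n (k + 1) ≤ n k + 1
  unimodal : ∀ {i j k}, i ≤ j → j ≤ k → min (n i) (n k) ≤ n j
  zero : ∀ {k}, h ≤ k → n k = 0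

/-- The largest value of a profile. -/
def height (h : ℕ) (n : ℕ → ℕ) : ℕ := (Finset.range h).sup n

theorem IsProfile.le_height {h : ℕ} {n : ℕ → ℕ} (hn : IsProfile h n) (k : ℕ) :
    n k ≤ height h n := by
  by_cases hk : k < h
  · exact Finset.le_sup (f := n) (Finset.mem_range.mpr hk)
  · rw [hn.zero (by omega)]
    exact Nat.zero_le _

theorem exists_eq_height {h : ℕ} (hh : 0 < h) (n : ℕ → ℕ) : ∃ k < h, n k = height h n := by
  obtain ⟨k, hk, e⟩ := Finset.exists_mem_eq_sup (Finset.range h) ⟨0, Finset.mem_range.mpr hh⟩ n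
  exact ⟨k, Finset.mem_range.mp hk, e.symm⟩

theorem IsProfile.le_add {h : ℕ} {n : ℕ → ℕ} (hn : IsProfile h n) (k j : ℕ) :
    n (k + j) ≤ n k + j := by
  induction j with
  | zero => simp
  | succ j ih =>
    have := hn.step (k + j)
    rw [← add_assoc]
    omega

/-- The symmetric polyomino with given profile outside the super-hexagon of radius `h`. -/
noncomputable def symmetricPolyomino (h : ℕ) (n : ℕ → ℕ) : Finset Cell :=
  (Finset.Icc (-(h + height h n) : ℤ) (h + height h n) ×ˢ
    Finset.Icc (-(h + height h n) : ℤ) (h + height h n)).filter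
      fun c => radius c.1 c.2 < h + n (offset c.1 c.2)

variable {h : ℕ} {n : ℕ → ℕ}

theorem IsProfile.mem_symmetricPolyomino (hn : IsProfile h n) {x y : ℤ} :
    (x, y) ∈ symmetricPolyomino h n ↔ radius x y < h + n (offset x y) := by
  rw [symmetricPolyomino, Finset.mem_filter]
  refine and_iff_right_of_imp fun hlt => ?_
  have := hn.le_height (offset x y)
  have h1 : x.natAbs ≤ radius x y := by unfold radius; omega
  have h2 : y.natAbs ≤ radius x y := by unfold radius; omega
  simp only at hlt
  simp only [Finset.mem_product, Finset.mem_Icc]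
  omega

/-- Membership in the sector between the directions north-west and north. -/
theorem IsProfile.neg_mem_symmetricPolyomino (hn : IsProfile h n) {k y : ℕ} (hk : k ≤ y) :
    ((-k : ℤ), (y : ℤ)) ∈ symmetricPolyomino h n ↔ y < h + n k := by
  rw [hn.mem_symmetricPolyomino]
  have h1 : radius (-k) y = y := by unfold radius; omega
  have h2 : offset (-k) y = k := by unfold offset; split_ifs <;> omega
  rw [h1, h2]

/-- Membership in the sector between the directions north and north-east. -/
theorem IsProfile.pos_mem_symmetricPolyomino (hn : IsProfile h n) {k y : ℕ} :
    ((k : ℤ), (y : ℤ)) ∈ symmetricPolyomino h n ↔ k + y < h + n k := by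
  rw [hn.mem_symmetricPolyomino]
  have h1 : radius k y = k + y := by unfold radius; omega
  have h2 : offset k y = k := by unfold offset; split_ifs <;> omega
  rw [h1, h2]

/-- Membership in the sector between the directions south-west and north-west. -/
theorem IsProfile.west_mem_symmetricPolyomino (hn : IsProfile h n) {k y : ℕ} (hk : y ≤ k) :
    ((-k : ℤ), (y : ℤ)) ∈ symmetricPolyomino h n ↔ k < h + n y := by
  rw [hn.mem_symmetricPolyomino]
  have h1 : radius (-k) y = k := by unfold radius; omega
  have h2 : offset (-k) y = y := by unfold offset; split_ifs <;> omega
  rw [h1, h2]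

theorem IsProfile.rot_mem (hn : IsProfile h n) {x y : ℤ} :
    (y, -x - y) ∈ symmetricPolyomino h n ↔ (x, y) ∈ symmetricPolyomino h n := by
  rw [hn.mem_symmetricPolyomino, hn.mem_symmetricPolyomino, radius_rot, offset_rot]

theorem IsProfile.vert_mem (hn : IsProfile h n) {x y : ℤ} :
    (-x, x + y) ∈ symmetricPolyomino h n ↔ (x, y) ∈ symmetricPolyomino h n := by
  rw [hn.mem_symmetricPolyomino, hn.mem_symmetricPolyomino, radius_vert, offset_vert]

/-- A row of nonnegative height crosses up to three sectors. To the right of the axis, the step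
condition propagates membership towards the axis. To the left, unimodality handles the sector next
to the axis, and in the following sector the condition only bounds the distance. -/
theorem IsProfile.isConvexAlong_northEast (hn : IsProfile h n) :
    IsConvexAlong northEast (symmetricPolyomino h n) := by
  have key : ∀ y : ℕ, ∀ a x b : ℤ, a ≤ x → x ≤ b → (a, (y : ℤ)) ∈ symmetricPolyomino h n →
      (b, (y : ℤ)) ∈ symmetricPolyomino h n → (x, (y : ℤ)) ∈ symmetricPolyomino h n := by
    intro y a x b hax hxb ha hb
    have hright : ∀ i j : ℕ, i ≤ j → ((j : ℤ), (y : ℤ)) ∈ symmetricPolyomino h n →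
        ((i : ℤ), (y : ℤ)) ∈ symmetricPolyomino h n := by
      intro i j hij hj
      rw [hn.pos_mem_symmetricPolyomino] at hj ⊢
      obtain ⟨m, rfl⟩ := Nat.exists_eq_add_of_le hij
      have := hn.le_add i m
      omega
    rcases le_total 0 x with hx | hx
    · lift x to ℕ using hx
      lift b to ℕ using by omega
      exact hright x b (by omega) hb
    obtain ⟨k, rfl⟩ : ∃ k : ℕ, x = -k := ⟨x.natAbs, by omega⟩
    obtain ⟨i, rfl⟩ : ∃ k : ℕ, a = -k := ⟨a.natAbs, by omega⟩
    rcases le_total y k with hy | hy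
    · rw [hn.west_mem_symmetricPolyomino (by omega)] at ha ⊢
      omega
    rw [hn.neg_mem_symmetricPolyomino hy]
    by_cases hyh : y < h
    · omega
    -- At height `y ≥ h` one has `n y = 0`, so the row does not reach the north-west ray.
    have hi : i < y := by
      by_contra hi
      rw [hn.west_mem_symmetricPolyomino (by omega), hn.zero (by omega)] at ha
      omega
    rw [hn.neg_mem_symmetricPolyomino hi.le] at ha
    obtain ⟨j, hj, hj'⟩ : ∃ j ≤ k, y < h + n j := by
      rcases le_total 0 b with hb0 | hb0
      · lift b to ℕ using hb0
        have := hright 0 b (Nat.zero_le _) hb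
        rw [hn.pos_mem_symmetricPolyomino] at this
        exact ⟨0, Nat.zero_le _, by omega⟩
      · obtain ⟨j, rfl⟩ : ∃ k : ℕ, b = -k := ⟨b.natAbs, by omega⟩
        rw [hn.neg_mem_symmetricPolyomino (by omega)] at hb
        exact ⟨j, by omega, hb⟩
    have := hn.unimodal hj (show k ≤ i by omega)
    omega
  refine _root_.isConvexAlong_northEast fun y a x b hax hxb ha hb => ?_
  rcases le_total 0 y with hy | hy
  · lift y to ℕ using hy
    exact key y a x b hax hxb ha hb
  -- The reflection in the axis through north-east belongs to the group and carries row `y` to row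
  -- `-y`.
  · have flip : ∀ x, (x, y) ∈ symmetricPolyomino h n ↔
        (x + y, -y) ∈ symmetricPolyomino h n := fun x => by
      rw [← hn.vert_mem, ← hn.rot_mem]
      convert Iff.rfl using 3
      ring
    rw [flip] at ha hb ⊢
    obtain ⟨z, rfl⟩ : ∃ k : ℕ, y = -k := ⟨y.natAbs, by omega⟩
    rw [neg_neg] at ha hb ⊢
    exact key z _ _ _ (by omega) (by omega) ha hb

/-- The rotation by `2π/3` permutes the three families of lines, so that columns, and likewise
diagonals, reduce to rows. -/
theorem IsProfile.isConvexAlong_north (hn : IsProfile h n) :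
    IsConvexAlong north (symmetricPolyomino h n) := by
  refine _root_.isConvexAlong_north fun x a y b hay hyb ha hb => ?_
  have e : ∀ t : ℤ, (x, t) ∈ symmetricPolyomino h n ↔ (-x - t, x) ∈ symmetricPolyomino h n :=
    fun t => by
      rw [← hn.rot_mem, ← hn.rot_mem]
      convert Iff.rfl using 3
      ring
  rw [e] at ha hb ⊢
  exact hn.isConvexAlong_northEast.northEast_mem hb ha (by omega) (by omega)

theorem IsProfile.isConvexAlong_northWest (hn : IsProfile h n) :
    IsConvexAlong northWest (symmetricPolyomino h n) := by
  refine _root_.isConvexAlong_northWest fun s a x b hax hxb ha hb => ?_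
  rw [← hn.rot_mem] at ha hb ⊢
  have e : ∀ t : ℤ, -t - (s - t) = -s := fun t => by ring
  rw [e] at ha hb ⊢
  exact hn.isConvexAlong_northEast.northEast_mem hb ha (by omega) (by omega)

/-- Each cell other than `(0, 0)` has a neighbour closer to `(0, 0)`. -/
theorem IsProfile.exists_closer (hn : IsProfile h n) (x y : ℤ) :
    (x, y) ∈ symmetricPolyomino h n → ¬(x = 0 ∧ y = 0) →
      ∃ x' y' : ℤ, (x', y') ∈ symmetricPolyomino h n ∧ ((x' - x, y' - y) : Cell) ∈ hexSteps ∧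
        radius x' y' < radius x y := by
  refine sector_induction (p := fun x y => (x, y) ∈ symmetricPolyomino h n → ¬(x = 0 ∧ y = 0) →
      ∃ x' y' : ℤ, (x', y') ∈ symmetricPolyomino h n ∧ ((x' - x, y' - y) : Cell) ∈ hexSteps ∧
        radius x' y' < radius x y) ?_ ?_ ?_ x y
  · intro x y ih ha hne
    obtain ⟨x', y', hb, hab, hlt⟩ := ih (hn.rot_mem.mpr ha) (by omega)
    refine ⟨-x' - y', x', ?_, ?_, ?_⟩
    · rw [← hn.rot_mem]
      convert hb using 2
      ring
    · rw [mk_mem_hexSteps] at hab ⊢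
      omega
    · rw [radius_rot] at hlt
      rw [← radius_rot]
      convert hlt using 2
      ring
  · intro x y ih ha hne
    obtain ⟨x', y', hb, hab, hlt⟩ := ih (hn.vert_mem.mpr ha) (by omega)
    refine ⟨-x', x' + y', hn.vert_mem.mpr hb, ?_, ?_⟩
    · rw [mk_mem_hexSteps] at hab ⊢
      omega
    · rwa [radius_vert] at hlt ⊢
  · intro x y hx hxy ha hne
    obtain ⟨k, rfl⟩ : ∃ k : ℕ, x = -k := ⟨x.natAbs, by omega⟩
    lift y to ℕ using by omega
    rw [hn.neg_mem_symmetricPolyomino (by omega)] at ha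
    -- On the north-west ray the closer cell is the previous one on the ray; elsewhere in the sector
    -- it is the south neighbour.
    by_cases hky : k = y
    · subst hky
      have hkh : k < h := by
        by_contra hk
        rw [hn.zero (by omega)] at ha
        omega
      obtain ⟨j, rfl⟩ := Nat.exists_eq_succ_of_ne_zero (show k ≠ 0 by omega)
      refine ⟨-j, j, (hn.neg_mem_symmetricPolyomino le_rfl).mpr (by omega), ?_, ?_⟩
      · rw [mk_mem_hexSteps]
        omega
      · unfold radius
        omega
    · obtain ⟨j, rfl⟩ := Nat.exists_eq_succ_of_ne_zero (show y ≠ 0 by omega)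
      refine ⟨-k, j, (hn.neg_mem_symmetricPolyomino (by omega)).mpr (by omega), ?_, ?_⟩
      · rw [mk_mem_hexSteps]
        omega
      · unfold radius
        omega

theorem IsProfile.isSymmetricConvex (hn : IsProfile h n) (hh : 0 < h) :
    IsSymmetricConvex (symmetricPolyomino h n) := by
  have h0 : ((0, 0) : Cell) ∈ symmetricPolyomino h n := by
    rw [hn.mem_symmetricPolyomino]
    simp [radius, offset]
    omega
  refine ⟨⟨isPolyomino_of_descent h0 (fun c => radius c.1 c.2) ?_, hn.isConvexAlong_north,
    hn.isConvexAlong_northEast, hn.isConvexAlong_northWest⟩, hn.rot_mem.mpr, hn.vert_mem.mpr⟩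
  rintro ⟨x, y⟩ ha hne
  obtain ⟨x', y', hb, hab, hlt⟩ := hn.exists_closer x y ha (by
    rintro ⟨rfl, rfl⟩
    exact hne rfl)
  exact ⟨(x', y'), hb, hab, hlt⟩

end Sectors

/-! ### From symmetric convex polyominoes to profiles. -/

section ProfileOfPolyomino

theorem exists_forall_iff_lt {p : ℕ → Prop} (hp : ∀ i j, i ≤ j → p j → p i) (hex : ∃ i, ¬p i) :
    ∃ m, ∀ i, p i ↔ i < m := by
  classical
  refine ⟨Nat.find hex, fun i => ⟨fun hi => ?_, fun hi => not_not.mp (Nat.find_min hex hi)⟩⟩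
  by_contra hlt
  exact Nat.find_spec hex (hp _ _ (not_lt.mp hlt) hi)

theorem exists_forall_mem_iff_lt {P : Finset Cell} {f : ℕ → Cell} (hf : Function.Injective f)
    (hp : ∀ i j, i ≤ j → f j ∈ P → f i ∈ P) : ∃ m, ∀ i, f i ∈ P ↔ i < m := by
  refine exists_forall_iff_lt hp ?_
  by_contra! hcon
  exact Set.infinite_range_of_injective hf (P.finite_toSet.subset (by
    rintro _ ⟨n, rfl⟩
    exact hcon n))

theorem extent_eq {P : Finset Cell} {d : Cell} (hd : d ≠ 0) {m : ℕ}
    (h : ∀ k : ℕ, k • d ∈ P ↔ k < m) : extent d P = m := by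
  have hinj : Function.Injective fun k : ℕ => k • d := fun i j hij => by
    have h' : (i : ℤ) • d = (j : ℤ) • d := by simpa using hij
    exact_mod_cast smul_left_injective ℤ hd h'
  have : {c : Cell | c ∈ P ∧ ∃ k : ℕ, c = k • d} =
      ((Finset.range m).image fun k : ℕ => k • d : Finset Cell) := by
    ext c
    simp only [Set.mem_ofPred_eq, Finset.coe_image, Finset.coe_range, Set.mem_image, Set.mem_Iio]
    constructor
    · rintro ⟨hc, k, rfl⟩
      exact ⟨k, (h k).mp hc, rfl⟩
    · rintro ⟨k, hk, rfl⟩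
      exact ⟨(h k).mpr hk, k, rfl⟩
  rw [extent, this, Set.ncard_coe_finset, Finset.card_image_of_injective _ hinj, Finset.card_range]

theorem IsConvexAlong.smul_mem_iff {P : Finset Cell} {d : Cell} (h : IsConvexAlong d P)
    (h0 : (0, 0) ∈ P) (hd : d ≠ 0) (k : ℕ) : k • d ∈ P ↔ k < extent d P := by
  have hinj : Function.Injective fun k : ℕ => k • d := fun i j hij => by
    have h' : (i : ℤ) • d = (j : ℤ) • d := by simpa using hij
    exact_mod_cast smul_left_injective ℤ hd h'
  obtain ⟨m, hm⟩ := exists_forall_mem_iff_lt (P := P) hinj (fun i j hij hj => by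
    have := h (0, 0) h0 j (by rw [Prod.mk_zero_zero, zero_add]; exact hj) i hij
    rw [Prod.mk_zero_zero, zero_add] at this
    exact this)
  rw [hm k, extent_eq hd hm]

/-- This is `vert` followed by two rotations: the reflection in the axis through north-west and
south-east, which bounds the fundamental sector. -/
theorem IsSymmetricConvex.mirror_mem {P : Finset Cell} (hP : IsSymmetricConvex P) {x y : ℤ}
    (h : (x, y) ∈ P) : (-y, -x) ∈ P := by
  have := hP.rot_mem (hP.rot_mem (hP.vert_mem h))
  convert this using 2 <;> ring

theorem IsSymmetricConvex.rot_mem_iff {P : Finset Cell} (hP : IsSymmetricConvex P) {x y : ℤ} :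
    (y, -x - y) ∈ P ↔ (x, y) ∈ P := by
  refine ⟨fun h => ?_, hP.rot_mem⟩
  have := hP.rot_mem (hP.rot_mem h)
  convert this using 2 <;> ring

theorem IsSymmetricConvex.vert_mem_iff {P : Finset Cell} (hP : IsSymmetricConvex P) {x y : ℤ} :
    (-x, x + y) ∈ P ↔ (x, y) ∈ P := by
  refine ⟨fun h => ?_, hP.vert_mem⟩
  have := hP.vert_mem h
  convert this using 2 <;> ring

/-- The centre of symmetry belongs to the polyomino. -/
theorem IsSymmetricConvex.zero_mem {P : Finset Cell} (hP : IsSymmetricConvex P) : (0, 0) ∈ P := by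
  by_contra h0
  -- A step changes the column by at most one and `vert` negates it, so a path from a cell to its
  -- mirror image meets column 0.
  have axis : ∃ b : ℤ, (0, b) ∈ P := by
    by_contra! hcon
    obtain ⟨⟨⟨x, y⟩, hc⟩⟩ := hP.convex.1.nonempty
    have hc : (x, y) ∈ P := hc
    rcases lt_trichotomy x 0 with hx | rfl | hx
    · have := hP.convex.1.induction (S := fun c => c.1 < 0) hc hx (by
        rintro ⟨a, b⟩ _ ⟨a', b'⟩ hb hab hS
        rw [Prod.mk_sub_mk, mk_mem_hexSteps] at hab
        have : a' ≠ 0 := by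
          rintro rfl
          exact hcon _ hb
        simp only at hS ⊢
        omega) (hP.vert_mem hc)
      simp only at this
      omega
    · exact hcon _ hc
    · have := hP.convex.1.induction (S := fun c => 0 < c.1) hc hx (by
        rintro ⟨a, b⟩ _ ⟨a', b'⟩ hb hab hS
        rw [Prod.mk_sub_mk, mk_mem_hexSteps] at hab
        have : a' ≠ 0 := by
          rintro rfl
          exact hcon _ hb
        simp only at hS ⊢
        omega) (hP.vert_mem hc)
      simp only at this
      omega
  obtain ⟨b, hb⟩ := axis
  -- Column 0 meets `P` in an interval avoiding the centre, so all its cells lie on the same side as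
  -- `b`.
  have col : ∀ c : ℤ, (0, c) ∈ P → b * c ≤ 0 → False := fun c hc hbc => by
    rcases mul_nonpos_iff.mp hbc with ⟨h1, h2⟩ | ⟨h1, h2⟩
    · exact h0 (hP.convex.2.1.north_mem hc hb h2 h1)
    · exact h0 (hP.convex.2.1.north_mem hb hc h1 h2)
  have hrot : (b, -b) ∈ P := by
    have := hP.rot_mem hb
    convert this using 2
    ring
  rcases lt_trichotomy b 0 with hneg | rfl | hpos
  -- A path from `(0, b)` to its rotated image leaves the open sector of angle 2π/3 around `(0, b)`.
  -- A cell on a bounding ray would rotate to a cell of column 0 at the centre or on the wrong side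
  -- of it.
  · have := hP.convex.1.induction (S := fun c => c.2 < 0 ∧ c.1 + c.2 < 0) hb
      ⟨hneg, by simpa using hneg⟩ (by
        rintro ⟨u, v⟩ _ ⟨x, y⟩ hc hab ⟨h1, h2⟩
        rw [Prod.mk_sub_mk, mk_mem_hexSteps] at hab
        simp only at h1 h2 ⊢
        by_contra hcon
        have hcon' : (y = 0 ∧ x ≤ 0) ∨ (x + y = 0 ∧ y ≤ 0) := by omega
        rcases hcon' with ⟨rfl, hx⟩ | ⟨hxy, hy⟩
        · refine col (-x) ?_ (mul_nonpos_of_nonpos_of_nonneg hneg.le (by omega))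
          have := hP.rot_mem hc
          convert this using 2
          ring
        · obtain rfl : x = -y := by omega
          refine col (-y) ?_ (mul_nonpos_of_nonpos_of_nonneg hneg.le (by omega))
          have := hP.rot_mem (hP.rot_mem hc)
          convert this using 2 <;> ring) hrot
    simp only at this
    omega
  · exact h0 hb
  · have := hP.convex.1.induction (S := fun c => 0 < c.2 ∧ 0 < c.1 + c.2) hb
      ⟨hpos, by simpa using hpos⟩ (by
        rintro ⟨u, v⟩ _ ⟨x, y⟩ hc hab ⟨h1, h2⟩
        rw [Prod.mk_sub_mk, mk_mem_hexSteps] at hab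
        simp only at h1 h2 ⊢
        by_contra hcon
        have hcon' : (y = 0 ∧ 0 ≤ x) ∨ (x + y = 0 ∧ 0 ≤ y) := by omega
        rcases hcon' with ⟨rfl, hx⟩ | ⟨hxy, hy⟩
        · refine col (-x) ?_ (mul_nonpos_of_nonneg_of_nonpos hpos.le (by omega))
          have := hP.rot_mem hc
          convert this using 2
          ring
        · obtain rfl : x = -y := by omega
          refine col (-y) ?_ (mul_nonpos_of_nonneg_of_nonpos hpos.le (by omega))
          have := hP.rot_mem (hP.rot_mem hc)
          convert this using 2 <;> ring) hrot
    simp only at this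
    omega

theorem IsSymmetricConvex.north_mem_iff {P : Finset Cell} (hP : IsSymmetricConvex P) (k : ℕ) :
    ((0 : ℤ), (k : ℤ)) ∈ P ↔ k < extent north P := by
  rw [← hP.convex.2.1.smul_mem_iff hP.zero_mem (by decide)]
  simp [north]

theorem IsSymmetricConvex.northEast_mem_iff {P : Finset Cell} (hP : IsSymmetricConvex P) (k : ℕ) :
    ((k : ℤ), (0 : ℤ)) ∈ P ↔ k < extent northEast P := by
  rw [← hP.convex.2.2.1.smul_mem_iff hP.zero_mem (by decide)]
  simp [northEast]

theorem IsSymmetricConvex.northWest_mem_iff {P : Finset Cell} (hP : IsSymmetricConvex P) (k : ℕ) :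
    ((-k : ℤ), (k : ℤ)) ∈ P ↔ k < extent northEast P := by
  rw [← hP.northEast_mem_iff, ← hP.vert_mem_iff, neg_neg, neg_add_cancel]

theorem IsSymmetricConvex.extent_northEast_pos {P : Finset Cell} (hP : IsSymmetricConvex P) :
    0 < extent northEast P :=
  (hP.northEast_mem_iff 0).mp hP.zero_mem

variable {P : Finset Cell} {h : ℕ}

/-- The row segment from `(-y, y)` to `(0, y)` has both ends in `P`, as both extents exceed `y`. -/
theorem IsSymmetricConvex.inner_mem (hP : IsSymmetricConvex P) (h1 : extent northEast P = h)
    (h2 : h ≤ extent north P) {k y : ℕ} (hk : k ≤ y) (hy : y < h) : ((-k : ℤ), (y : ℤ)) ∈ P :=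
  hP.convex.2.2.1.northEast_mem ((hP.northWest_mem_iff y).mpr (by omega))
    ((hP.north_mem_iff y).mpr (by omega)) (by omega) (by omega)

/-- A path to the centre would have to leave the part of the sector with columns at most `-h`. It
cannot cross the north-west ray, whose cells in `P` stop before radius `h`. Entering column `-(h -
1)` would put `(-(h - 1), h)` in `P`, hence its mirror image `(-h, h - 1)`, and column `-h` would
then contain `(-h, h)`, against the extent. -/
theorem IsSymmetricConvex.outer_notMem (hP : IsSymmetricConvex P) (h1 : extent northEast P = h)
    (h2 : h ≤ extent north P) {k y : ℕ} (hk : h ≤ k) (hy : k ≤ y) : ((-k : ℤ), (y : ℤ)) ∉ P := by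
  intro hmem
  have hpos : 0 < h := h1 ▸ hP.extent_northEast_pos
  have := hP.convex.1.induction (S := fun c => c.1 ≤ -h ∧ 0 ≤ c.1 + c.2) hmem (by
    simp only
    omega) (by
    rintro ⟨x, y⟩ ha ⟨x', y'⟩ hb hab ⟨hx, hxy⟩
    rw [Prod.mk_sub_mk, mk_mem_hexSteps] at hab
    simp only at hx hxy ⊢
    have hne : x + y ≠ 0 := fun h0 => by
      have := (hP.northWest_mem_iff y.toNat).mp (by
        convert ha using 2 <;> omega)
      omega
    by_contra hcon
    have e1 : x = -h := by omega
    have e2 : x' = -(h - 1 : ℕ) := by omega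
    subst e1
    have h3 : ((-(h - 1 : ℕ) : ℤ), (h : ℤ)) ∈ P :=
      hP.convex.2.1.north_mem (hP.inner_mem h1 h2 (le_refl (h - 1)) (by omega)) (e2 ▸ hb)
        (by omega) (by omega)
    have h4 := hP.mirror_mem h3
    rw [neg_neg] at h4
    have h5 : ((-h : ℤ), (h : ℤ)) ∈ P := hP.convex.2.1.north_mem h4 ha (by omega) (by omega)
    rw [hP.northWest_mem_iff] at h5
    omega) hP.zero_mem
  simp only at this
  omega

theorem IsSymmetricConvex.exists_profile (hP : IsSymmetricConvex P) (h1 : extent northEast P = h)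
    (h2 : h ≤ extent north P) : ∃ n, IsProfile h n ∧ symmetricPolyomino h n = P := by
  have hpos : 0 < h := h1 ▸ hP.extent_northEast_pos
  have hex : ∀ k : ℕ, ∃ m : ℕ, (k < h → ∀ j : ℕ, ((-k : ℤ), (h + j : ℤ)) ∈ P ↔ j < m) ∧
      (h ≤ k → m = 0) := by
    intro k
    by_cases hk : k < h
    · obtain ⟨m, hm⟩ := exists_forall_mem_iff_lt (P := P)
        (f := fun j : ℕ => ((-k : ℤ), (h + j : ℤ))) (fun i j hij => by simpa using hij)
        (fun i j hij hj => hP.convex.2.1.north_mem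
          (hP.inner_mem h1 h2 (show k ≤ h - 1 by omega) (by omega)) hj (by omega) (by omega))
      exact ⟨m, fun _ => hm, fun hk' => by omega⟩
    · exact ⟨0, fun hk' => by omega, fun _ => rfl⟩
  choose n hn hzero using hex
  have hprof : IsProfile h n := by
    refine ⟨fun k => ?_, fun {i j k} hij hjk => ?_, hzero _⟩
    -- A cell `ha` too high in column `-(k + 1)` has a mirror image in column `k + 1`. With the
    -- super-hexagon below it, this gives `hb` on the north-west line through `ha`. Between the two,
    -- that line passes through `(-k, h + n k)`, the first missing cell above column `-k`.
    · by_contra! hcon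
      have hk : k + 1 < h := by
        by_contra hk
        rw [hzero (k + 1) (by omega)] at hcon
        omega
      have ha := (hn (k + 1) hk (n k + 1)).mpr hcon
      -- The lowest cell of the super-hexagon in column `k + 1`, obtained from the cell `(-(h - 2 -
      -- k), h - 1)` of its top side by a rotation and a reflection.
      have hcorner : ((k + 1 : ℤ), (-(h - 1 : ℕ) : ℤ)) ∈ P := by
        have := hP.mirror_mem (hP.rot_mem
          (hP.inner_mem h1 h2 (show h - 2 - k ≤ h - 1 by omega) (by omega)))
        convert this using 2
        omega
      have hb := hP.convex.2.1.north_mem (y := h + n k - 2 * k - 1) hcorner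
        (b := h + n k - k) (by
          have := hP.vert_mem ha
          convert this using 2 <;> push_cast <;> ring) (by omega) (by omega)
      have hc : ((-k : ℤ), (h + n k : ℤ)) ∈ P :=
        hP.convex.2.2.2.northWest_mem (s := h + n k - k) (a := -(k + 1)) (b := k + 1)
          (by convert ha using 2 <;> push_cast <;> ring)
          (by convert hb using 2; ring) (by omega) (by omega) (by ring)
      exact lt_irrefl _ ((hn k (by omega) (n k)).mp hc)
    -- Row `h + n j` would meet columns `-k` and `-i`, hence also column `-j` just above its pile.
    · by_contra! hcon
      have hk : k < h := by
        by_contra hk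
        rw [hzero k (by omega)] at hcon
        omega
      have hi := (hn i (by omega) (n j)).mpr (by omega)
      have hk' := (hn k hk (n j)).mpr (by omega)
      have hj : ((-j : ℤ), (h + n j : ℤ)) ∈ P :=
        hP.convex.2.2.1.northEast_mem hk' hi (by omega) (by omega)
      exact lt_irrefl _ ((hn j (by omega) (n j)).mp hj)
  refine ⟨n, hprof, ?_⟩
  ext ⟨x, y⟩
  refine sector_induction (p := fun x y => (x, y) ∈ symmetricPolyomino h n ↔ (x, y) ∈ P)
    ?_ ?_ ?_ x y
  · intro x y ih
    rwa [hprof.rot_mem, hP.rot_mem_iff] at ih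
  · intro x y ih
    rwa [hprof.vert_mem, hP.vert_mem_iff] at ih
  · intro x y hx hxy
    obtain ⟨k, rfl⟩ : ∃ k : ℕ, x = -k := ⟨x.natAbs, by omega⟩
    lift y to ℕ using by omega
    rw [hprof.neg_mem_symmetricPolyomino (by omega)]
    by_cases hk : k < h
    · by_cases hy : y < h
      · exact iff_of_true (by omega) (hP.inner_mem h1 h2 (by omega) hy)
      · obtain ⟨j, rfl⟩ := Nat.exists_eq_add_of_le (not_lt.mp hy)
        rw [add_lt_add_iff_left, ← hn k hk, Nat.cast_add]
    · refine iff_of_false ?_ (hP.outer_notMem h1 h2 (by omega) (by omega))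
      rw [hzero k (by omega)]
      omega

variable {n : ℕ → ℕ}

theorem IsProfile.extent_north (hn : IsProfile h n) :
    extent north (symmetricPolyomino h n) = h + n 0 := by
  refine extent_eq (by decide) fun k => ?_
  have e : k • north = ((-(0 : ℕ) : ℤ), (k : ℤ)) := by simp [north]
  rw [e, hn.neg_mem_symmetricPolyomino (Nat.zero_le _)]

theorem IsProfile.extent_northEast (hn : IsProfile h n) :
    extent northEast (symmetricPolyomino h n) = h := by
  refine extent_eq (by decide) fun k => ?_
  have e : k • northEast = ((k : ℤ), ((0 : ℕ) : ℤ)) := by simp [northEast]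
  rw [e, hn.pos_mem_symmetricPolyomino]
  by_cases hk : h ≤ k
  · rw [hn.zero hk]
    omega
  · omega

theorem symmetricPolyomino_injOn : Set.InjOn (symmetricPolyomino h) {n | IsProfile h n} := by
  intro n hn n' hn' heq
  have hn : IsProfile h n := hn
  have hn' : IsProfile h n' := hn'
  funext k
  by_cases hk : h ≤ k
  · rw [hn.zero hk, hn'.zero hk]
  · have key : ∀ j, j < n k ↔ j < n' k := fun j => by
      have h1 := hn.neg_mem_symmetricPolyomino (show k ≤ h + j by omega)
      rw [heq, hn'.neg_mem_symmetricPolyomino (by omega)] at h1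
      omega
    have h1 := key (n k)
    have h2 := key (n' k)
    omega

end ProfileOfPolyomino

/-! ### Area and half perimeter in terms of the profile. -/

section AreaAndPerimeter

variable {P : Finset Cell} {h : ℕ} {n : ℕ → ℕ}

/-- The symmetries permute columns, rows and diagonals, so the three families contribute equally to
the half perimeter. -/
theorem IsSymmetricConvex.image_fst (hP : IsSymmetricConvex P) :
    P.image Prod.fst = P.image Prod.snd := by
  ext a
  simp only [Finset.mem_image, Prod.exists, exists_and_right, exists_eq_right]
  constructor
  · rintro ⟨y, hy⟩
    refine ⟨-a - y, ?_⟩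
    have := hP.rot_mem (hP.rot_mem hy)
    convert this using 2
    ring
  · rintro ⟨x, hx⟩
    exact ⟨_, hP.rot_mem hx⟩

theorem IsSymmetricConvex.image_add (hP : IsSymmetricConvex P) :
    (P.image fun c => c.1 + c.2) = P.image Prod.snd := by
  ext a
  simp only [Finset.mem_image, Prod.exists, exists_eq_right]
  constructor
  · rintro ⟨x, y, hy, rfl⟩
    exact ⟨_, hP.vert_mem hy⟩
  · rintro ⟨x, hx⟩
    exact ⟨_, _, hP.vert_mem hx, by ring⟩

theorem IsSymmetricConvex.halfPerimeter_eq (hP : IsSymmetricConvex P) :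
    halfPerimeter P = 3 * (P.image Prod.snd).card := by
  rw [halfPerimeter_eq_card_lines hP.convex.2.1 hP.convex.2.2.1 hP.convex.2.2.2, hP.image_fst,
    hP.image_add]
  ring

/-- Rows of height less than `h` meet the axis column, higher ones meet a tallest pile, and negative
ones follow by a reflection. -/
theorem IsProfile.image_snd (hn : IsProfile h n) (hh : 0 < h) :
    (symmetricPolyomino h n).image Prod.snd =
      Finset.Icc (-(h - 1 + height h n : ℕ) : ℤ) (h - 1 + height h n : ℕ) := by
  have hP := hn.isSymmetricConvex hh
  have hpos : ∀ y : ℕ, y ≤ h - 1 + height h n → ∃ x : ℤ, (x, (y : ℤ)) ∈ symmetricPolyomino h n := by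
    intro y hy
    by_cases hyh : y < h
    · exact ⟨-(0 : ℕ), (hn.neg_mem_symmetricPolyomino (Nat.zero_le _)).mpr (by omega)⟩
    · obtain ⟨k, hk, e⟩ := exists_eq_height hh n
      exact ⟨-k, (hn.neg_mem_symmetricPolyomino (by omega)).mpr (by omega)⟩
  ext a
  simp only [Finset.mem_image, Prod.exists, exists_eq_right, Finset.mem_Icc]
  constructor
  · rintro ⟨x, hx⟩
    rw [hn.mem_symmetricPolyomino] at hx
    have := hn.le_height (offset x a)
    have h2 : a.natAbs ≤ radius x a := by unfold radius; omega
    omega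
  · rintro ⟨h1, h2⟩
    obtain ⟨x, hx⟩ := hpos a.natAbs (by omega)
    rcases Int.natAbs_eq a with ha | ha
    · exact ⟨x, by rwa [ha]⟩
    · refine ⟨x + a.natAbs, ?_⟩
      have := hP.rot_mem (hP.vert_mem hx)
      convert this using 2
      omega

theorem IsProfile.halfPerimeter_symmetricPolyomino (hn : IsProfile h n) (hh : 0 < h) :
    halfPerimeter (symmetricPolyomino h n) = 6 * height h n + 3 * (2 * h - 1) := by
  rw [(hn.isSymmetricConvex hh).halfPerimeter_eq, hn.image_snd hh, Int.card_Icc]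
  omega

/-- The cells other than the centre are shared out between three sectors exchanged by the
rotation by `2π/3`. -/
theorem IsSymmetricConvex.card_eq (hP : IsSymmetricConvex P) :
    P.card = 3 * (P.filter fun c => 0 ≤ c.2 ∧ 0 < c.1 + c.2).card + 1 := by
  -- The sectors are half-open, each keeping one of its two bounding rays, so that every cell other
  -- than the centre is counted once.
  set A := P.filter fun c => 0 ≤ c.2 ∧ 0 < c.1 + c.2 with hA
  set B := P.filter fun c => 0 ≤ c.1 ∧ c.2 < 0 with hB
  set C := P.filter fun c => c.1 + c.2 ≤ 0 ∧ c.1 < 0 with hC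
  have hAB : A.card = B.card := by
    refine Finset.card_bij' (fun c _ => (c.2, -c.1 - c.2)) (fun c _ => (-c.1 - c.2, c.1)) ?_ ?_ ?_ ?_
    · rintro ⟨x, y⟩ hc
      simp only [hA, hB, Finset.mem_filter] at hc ⊢
      exact ⟨hP.rot_mem hc.1, by omega⟩
    · rintro ⟨x, y⟩ hc
      simp only [hA, hB, Finset.mem_filter] at hc ⊢
      refine ⟨?_, by omega⟩
      rw [← hP.rot_mem_iff]
      convert hc.1 using 2
      ring
    · rintro ⟨x, y⟩ _
      ext
      · simp only
        ring
      · rfl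
    · rintro ⟨x, y⟩ _
      ext
      · rfl
      · simp only
        ring
  have hBC : B.card = C.card := by
    refine Finset.card_bij' (fun c _ => (c.2, -c.1 - c.2)) (fun c _ => (-c.1 - c.2, c.1)) ?_ ?_ ?_ ?_
    · rintro ⟨x, y⟩ hc
      simp only [hC, hB, Finset.mem_filter] at hc ⊢
      exact ⟨hP.rot_mem hc.1, by omega⟩
    · rintro ⟨x, y⟩ hc
      simp only [hC, hB, Finset.mem_filter] at hc ⊢
      refine ⟨?_, by omega⟩
      rw [← hP.rot_mem_iff]
      convert hc.1 using 2
      ring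
    · rintro ⟨x, y⟩ _
      ext
      · simp only
        ring
      · rfl
    · rintro ⟨x, y⟩ _
      ext
      · rfl
      · simp only
        ring
  have hunion : P = insert (0, 0) (A ∪ (B ∪ C)) := by
    ext ⟨x, y⟩
    simp only [hA, hB, hC, Finset.mem_insert, Finset.mem_union, Finset.mem_filter, Prod.mk.injEq]
    constructor
    · intro hc
      simp only [hc, true_and]
      omega
    · rintro (⟨rfl, rfl⟩ | hc | hc | hc)
      · exact hP.zero_mem
      · exact hc.1
      · exact hc.1
      · exact hc.1
  rw [hunion, Finset.card_insert_of_notMem, Finset.card_union_of_disjoint,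
    Finset.card_union_of_disjoint, ← hBC, ← hAB]
  · ring
  · refine Finset.disjoint_left.mpr ?_
    rintro ⟨x, y⟩ h1 h2
    simp only [hB, hC, Finset.mem_filter] at h1 h2
    omega
  · refine Finset.disjoint_left.mpr ?_
    rintro ⟨x, y⟩ h1 h2
    simp only [hA, hB, hC, Finset.mem_filter, Finset.mem_union] at h1 h2
    omega
  · simp [hA, hB, hC]

/-- A half-open sector of angle 2π/3 is cut into columns `-k` and `k + 1`, of sizes `h - 1 - k + n
k` and `h - 1 - k + n (k + 1)`. Each sector thus counts `n 0` once and the other values of `n`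
twice, whence the correction `3 * n 0`. -/
theorem IsProfile.card_symmetricPolyomino (hn : IsProfile h n) (hh : 0 < h) :
    (symmetricPolyomino h n).card + 3 * n 0 =
      6 * ∑ k ∈ Finset.range h, n k + (3 * h * (h - 1) + 1) := by
  set P := symmetricPolyomino h n
  have h1 : ((P.filter fun c => 0 ≤ c.2 ∧ 0 < c.1 + c.2).filter fun c => c.1 ≤ 0).card =
      ∑ k ∈ Finset.range h, (h - 1 - k + n k) := by
    have : ∑ k ∈ Finset.range h, (h - 1 - k + n k) =
        ((Finset.range h).sigma fun k => Finset.range (h - 1 - k + n k)).card := by simp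
    rw [this]
    symm
    refine Finset.card_bij (fun a _ => ((-a.1 : ℤ), ((a.1 + 1 + a.2 : ℕ) : ℤ))) ?_ ?_ ?_
    · rintro ⟨k, j⟩ ha
      simp only [Finset.mem_sigma, Finset.mem_range] at ha
      simp only [Finset.mem_filter]
      refine ⟨⟨(hn.neg_mem_symmetricPolyomino (by omega)).mpr (by omega), by omega⟩, by omega⟩
    · rintro ⟨k, j⟩ _ ⟨k', j'⟩ _ heq
      simp only [Prod.mk.injEq] at heq
      obtain rfl : k = k' := by omega
      obtain rfl : j = j' := by omega
      rfl
    · rintro ⟨x, y⟩ hc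
      simp only [Finset.mem_filter] at hc
      obtain ⟨⟨hc, hy, hxy⟩, hx⟩ := hc
      obtain ⟨k, rfl⟩ : ∃ k : ℕ, x = -k := ⟨x.natAbs, by omega⟩
      obtain ⟨y, rfl⟩ := Int.eq_ofNat_of_zero_le hy
      have hc := (hn.neg_mem_symmetricPolyomino (by omega)).mp hc
      have hk : k < h := by
        by_contra hk
        rw [hn.zero (by omega)] at hc
        omega
      refine ⟨⟨k, y - (k + 1)⟩, ?_, ?_⟩
      · simp only [Finset.mem_sigma, Finset.mem_range]
        omega
      · simp only [Prod.mk.injEq, true_and]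
        omega
  have h2 : ((P.filter fun c => 0 ≤ c.2 ∧ 0 < c.1 + c.2).filter fun c => ¬c.1 ≤ 0).card =
      ∑ k ∈ Finset.range h, (h - 1 - k + n (k + 1)) := by
    have : ∑ k ∈ Finset.range h, (h - 1 - k + n (k + 1)) =
        ((Finset.range h).sigma fun k => Finset.range (h - 1 - k + n (k + 1))).card := by simp
    rw [this]
    symm
    refine Finset.card_bij (fun a _ => (((a.1 + 1 : ℕ) : ℤ), (a.2 : ℤ))) ?_ ?_ ?_
    · rintro ⟨k, j⟩ ha
      simp only [Finset.mem_sigma, Finset.mem_range] at ha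
      simp only [Finset.mem_filter]
      refine ⟨⟨hn.pos_mem_symmetricPolyomino.mpr (by omega), by omega⟩, by omega⟩
    · rintro ⟨k, j⟩ _ ⟨k', j'⟩ _ heq
      simp only [Prod.mk.injEq] at heq
      obtain rfl : k = k' := by omega
      obtain rfl : j = j' := by omega
      rfl
    · rintro ⟨x, y⟩ hc
      simp only [Finset.mem_filter] at hc
      obtain ⟨⟨hc, hy, hxy⟩, hx⟩ := hc
      obtain ⟨k, rfl⟩ : ∃ k : ℕ, x = (k + 1 : ℕ) := ⟨(x - 1).natAbs, by omega⟩
      obtain ⟨y, rfl⟩ := Int.eq_ofNat_of_zero_le hy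
      have hc := hn.pos_mem_symmetricPolyomino.mp hc
      have hk : k < h := by
        by_contra hk
        rw [hn.zero (by omega)] at hc
        omega
      refine ⟨⟨k, y⟩, ?_, rfl⟩
      simp only [Finset.mem_sigma, Finset.mem_range]
      omega
  have h3 := (hn.isSymmetricConvex hh).card_eq
  rw [← Finset.card_filter_add_card_filter_not (s := P.filter _) (p := fun c : Cell => c.1 ≤ 0), h1, h2,
    Finset.sum_add_distrib, Finset.sum_add_distrib] at h3
  have h4 : ∑ k ∈ Finset.range h, n (k + 1) + n 0 = ∑ k ∈ Finset.range h, n k := by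
    rw [← Finset.sum_range_succ', Finset.sum_range_succ, hn.zero le_rfl, add_zero]
  have h5 := Finset.sum_range_id_mul_two h
  rw [← Finset.sum_range_reflect (fun k => k)] at h5
  have h6 : 3 * h * (h - 1) = 3 * (h * (h - 1)) := mul_assoc _ _ _
  change (symmetricPolyomino h n).card = _ at h3
  change (symmetricPolyomino h n).card + _ = _
  omega

end AreaAndPerimeter

/-! ### Profiles vanishing on the axis and the stack polynomials. -/

section Stacks

theorem height_eq {h m : ℕ} {n : ℕ → ℕ} (h1 : ∀ k < h, n k ≤ m) (h2 : ∃ k < h, n k = m) :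
    height h n = m := by
  refine le_antisymm (Finset.sup_le fun k hk => h1 k (Finset.mem_range.mp hk)) ?_
  obtain ⟨k, hk, rfl⟩ := h2
  exact Finset.le_sup (f := n) (Finset.mem_range.mpr hk)

/-- The number of cells described by a profile. -/
def profileSum (h : ℕ) (n : ℕ → ℕ) : ℕ := ∑ k ∈ Finset.range h, n k

theorem finite_isProfile (h l : ℕ) : {n | IsProfile h n ∧ n 0 = l}.Finite := by
  refine Set.Finite.of_injOn (f := fun (n : ℕ → ℕ) (k : Fin h) => n k)
    (t := (Set.univ : Set (Fin h)).pi fun k => Set.Iic (l + k)) ?_ ?_ ?_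
  · rintro n ⟨hn, hl⟩ k -
    have := hn.le_add 0 k
    rw [zero_add, hl] at this
    exact this
  · rintro n ⟨hn, -⟩ n' ⟨hn', -⟩ heq
    funext k
    by_cases hk : k < h
    · exact congrFun heq ⟨k, hk⟩
    · rw [hn.zero (by omega), hn'.zero (by omega)]
  · exact Set.Finite.pi fun k : Fin h => Set.finite_Iic (l + k : ℕ)

/-- The profile moved away from the axis by one column. -/
def shiftProfile (n : ℕ → ℕ) : ℕ → ℕ
  | 0 => 0
  | k + 1 => n k

/-- The profile of `h` columns raised by one and moved away from the axis by one column. -/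
def raiseProfile (h : ℕ) (n : ℕ → ℕ) : ℕ → ℕ
  | 0 => 0
  | k + 1 => if k < h then n k + 1 else 0

variable {h : ℕ} {n : ℕ → ℕ}

theorem profileSum_shiftProfile : profileSum (h + 1) (shiftProfile n) = profileSum h n := by
  rw [profileSum, Finset.sum_range_succ']
  rfl

theorem profileSum_raiseProfile : profileSum (h + 1) (raiseProfile h n) = profileSum h n + h := by
  rw [profileSum, Finset.sum_range_succ']
  simp only [raiseProfile, add_zero]
  rw [Finset.sum_congr rfl fun k hk => if_pos (Finset.mem_range.mp hk), Finset.sum_add_distrib]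
  simp [profileSum]

theorem height_shiftProfile (hh : 0 < h) : height (h + 1) (shiftProfile n) = height h n := by
  refine height_eq ?_ ?_
  · rintro (_ | k) hk
    · exact Nat.zero_le _
    · exact Finset.le_sup (f := n) (Finset.mem_range.mpr (by omega))
  · obtain ⟨k, hk, e⟩ := exists_eq_height hh n
    exact ⟨k + 1, by omega, e⟩

theorem height_raiseProfile (hh : 0 < h) :
    height (h + 1) (raiseProfile h n) = height h n + 1 := by
  refine height_eq ?_ ?_
  · rintro (_ | k) hk
    · exact Nat.zero_le _
    · have : n k ≤ height h n := Finset.le_sup (f := n) (Finset.mem_range.mpr (by omega))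
      simp only [raiseProfile]
      split_ifs <;> omega
  · obtain ⟨k, hk, e⟩ := exists_eq_height hh n
    exact ⟨k + 1, by omega, by simp [raiseProfile, hk, e]⟩

theorem IsProfile.profileSum_succ (hn : IsProfile h n) : profileSum (h + 1) n = profileSum h n := by
  rw [profileSum, Finset.sum_range_succ, hn.zero le_rfl, add_zero, profileSum]

theorem IsProfile.height_succ (hn : IsProfile h n) (hh : 0 < h) :
    height (h + 1) n = height h n := by
  refine height_eq (fun k _ => hn.le_height k) ?_
  obtain ⟨k, hk, e⟩ := exists_eq_height hh n
  exact ⟨k, by omega, e⟩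

/-- The profiles of the stacks placed on `h - 1` cells. -/
def stackProfiles (h : ℕ) : Set (ℕ → ℕ) := {n | IsProfile h n ∧ n 0 = 0}

theorem bijOn_shiftProfile (h : ℕ) : Set.BijOn shiftProfile (stackProfiles h)
    {n ∈ stackProfiles (h + 1) | n 1 = 0} := by
  refine ⟨?_, ?_, ?_⟩
  · rintro n ⟨hn, h0⟩
    refine ⟨⟨⟨?_, ?_, ?_⟩, rfl⟩, h0⟩
    · rintro (_ | k)
      · exact h0.le.trans (Nat.zero_le _)
      · exact hn.step k
    · rintro (_ | i) (_ | j) (_ | k) h1 h2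
      all_goals first
        | omega
        | simp [shiftProfile]; done
        | exact hn.unimodal (by omega) (by omega)
    · rintro (_ | k) hk
      · rfl
      · exact hn.zero (by omega)
  · intro n _ n' _ heq
    funext k
    exact congrFun heq (k + 1)
  · rintro n ⟨⟨hn, h0⟩, h1⟩
    refine ⟨fun k => n (k + 1), ⟨⟨fun k => hn.step _, fun h1 h2 => hn.unimodal (by omega) (by omega),
      fun hk => hn.zero (by omega)⟩, h1⟩, ?_⟩
    funext k
    rcases k with _ | k
    · exact h0.symm
    · rfl

/-- When both end columns are nonempty, unimodality makes the bottom row full, with `h + 1` cells.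
Since `n 0 = 0` forces `n 1 = 1`, removing this row empties column 1, and the rest can be moved one
column towards the axis. -/
theorem bijOn_raiseProfile (h : ℕ) : Set.BijOn (raiseProfile (h + 1)) (stackProfiles (h + 1))
    {n ∈ stackProfiles (h + 2) | n 1 ≠ 0 ∧ n (h + 1) ≠ 0} := by
  refine ⟨?_, ?_, ?_⟩
  · rintro n ⟨hn, h0⟩
    refine ⟨⟨⟨?_, ?_, ?_⟩, rfl⟩, by simp [raiseProfile], by simp [raiseProfile]⟩
    · rintro (_ | k)
      · simp [raiseProfile, h0]
      · have := hn.step k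
        simp only [raiseProfile]
        split_ifs <;> omega
    · rintro (_ | i) (_ | j) (_ | k) h1 h2
      all_goals try omega
      all_goals try simp [raiseProfile]; done
      have := hn.unimodal (show i ≤ j by omega) (show j ≤ k by omega)
      simp only [raiseProfile]
      split_ifs <;> omega
    · rintro (_ | k) hk
      · rfl
      · simp only [raiseProfile]
        exact if_neg (by omega)
  · rintro n ⟨hn, -⟩ n' ⟨hn', -⟩ heq
    funext k
    have := congrFun heq (k + 1)
    simp only [raiseProfile] at this
    by_cases hk : k < h + 1
    · rw [if_pos hk, if_pos hk] at this
      omega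
    · rw [hn.zero (by omega), hn'.zero (by omega)]
  · rintro n ⟨⟨hn, h0⟩, h1, h2⟩
    have hpos : ∀ k, k ≤ h → n (k + 1) ≠ 0 := fun k hk => by
      have := hn.unimodal (show 1 ≤ k + 1 by omega) (show k + 1 ≤ h + 1 by omega)
      omega
    have hone : n 1 ≤ 1 := by
      have : n 1 ≤ n 0 + 1 := hn.step 0
      omega
    refine ⟨fun k => n (k + 1) - 1, ⟨⟨fun k => ?_, fun {i j k} h1 h2 => ?_, fun {k} hk => ?_⟩,
      ?_⟩, ?_⟩
    · have := hn.step (k + 1)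
      omega
    · have := hn.unimodal (show i + 1 ≤ j + 1 by omega) (show j + 1 ≤ k + 1 by omega)
      omega
    · rw [hn.zero (by omega)]
    · simp only [zero_add]
      omega
    · funext k
      rcases k with _ | k
      · exact h0.symm
      · simp only [raiseProfile]
        split_ifs with hk
        · have := hpos k (by omega)
          omega
        · exact (hn.zero (by omega)).symm

theorem setOf_stackProfiles_last (h : ℕ) :
    {n ∈ stackProfiles (h + 1) | n h = 0} = stackProfiles h := by
  ext n
  constructor
  · rintro ⟨⟨hn, h0⟩, h1⟩
    refine ⟨⟨hn.step, hn.unimodal, fun {k} hk => ?_⟩, h0⟩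
    rcases Nat.eq_or_lt_of_le hk with rfl | hk
    · exact h1
    · exact hn.zero hk
  · rintro ⟨hn, h0⟩
    exact ⟨⟨⟨hn.step, hn.unimodal, fun hk => hn.zero (by omega)⟩, h0⟩, hn.zero le_rfl⟩

/-- The series of stacks, by area and number of rows. -/
noncomputable def stackSeries (h : ℕ) : QTSeries :=
  genSeries (stackProfiles h) (profileSum h) (height h)

theorem genSeries_stackProfiles_succ {h : ℕ} (hh : 0 < h) :
    genSeries (stackProfiles h) (profileSum (h + 1)) (height (h + 1)) = stackSeries h :=
  genSeries_congr (fun _ hn => hn.1.profileSum_succ) (fun _ hn => hn.1.height_succ hh)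

/-- Inclusion-exclusion: an empty first column and an empty last column each give `stackSeries (h +
1)`, both together give `stackSeries h`, and otherwise a full bottom row of weight `tVar * qVar ^ (h
+ 1)` can be removed. -/
theorem stackSeries_succ_succ {h : ℕ} (hh : 0 < h) : stackSeries (h + 2) =
    (2 + tVar * qVar ^ (h + 1)) * stackSeries (h + 1) - stackSeries h := by
  set S := stackProfiles (h + 2) with hS
  set A := {n ∈ S | n 1 = 0} with hA
  set B := {n ∈ S | n (h + 1) = 0} with hB
  set C := {n ∈ S | n 1 ≠ 0 ∧ n (h + 1) ≠ 0} with hC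
  have hSfin : S.Finite := finite_isProfile _ _
  have hAfin : A.Finite := hSfin.subset fun n hn => hn.1
  have hBfin : B.Finite := hSfin.subset fun n hn => hn.1
  have hCfin : C.Finite := hSfin.subset fun n hn => hn.1
  have hABC : A ∪ B ∪ C = S := by
    ext n
    constructor
    · rintro ((hn | hn) | hn) <;> exact hn.1
    · intro hn
      by_cases h1 : n 1 = 0
      · exact Or.inl (Or.inl ⟨hn, h1⟩)
      · by_cases h2 : n (h + 1) = 0
        · exact Or.inl (Or.inr ⟨hn, h2⟩)
        · exact Or.inr ⟨hn, h1, h2⟩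
  have hdisj : (A ∪ B) ∩ C = ∅ := by
    refine Set.eq_empty_of_forall_notMem ?_
    rintro n ⟨hn | hn, hc⟩
    · exact hc.2.1 hn.2
    · exact hc.2.2 hn.2
  have hBeq : B = stackProfiles (h + 1) := setOf_stackProfiles_last (h + 1)
  have hAB : A ∩ B = {n ∈ stackProfiles (h + 1) | n 1 = 0} := by
    rw [← hBeq]
    ext n
    exact ⟨fun hn => ⟨hn.2, hn.1.2⟩, fun hn => ⟨⟨hn.1.1, hn.2⟩, hn.1⟩⟩
  have e1 := genSeries_union_add_inter (profileSum (h + 2)) (height (h + 2)) hAfin hBfin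
  have e2 := genSeries_union_add_inter (profileSum (h + 2)) (height (h + 2)) (hAfin.union hBfin)
    hCfin
  have gA : genSeries A (profileSum (h + 2)) (height (h + 2)) = stackSeries (h + 1) := by
    rw [genSeries_eq_of_bijOn (bijOn_shiftProfile (h + 1))]
    exact genSeries_congr (fun _ _ => profileSum_shiftProfile)
      (fun _ _ => height_shiftProfile (by omega))
  have gB : genSeries B (profileSum (h + 2)) (height (h + 2)) = stackSeries (h + 1) := by
    rw [hBeq]
    exact genSeries_stackProfiles_succ (by omega)
  have gAB : genSeries (A ∩ B) (profileSum (h + 2)) (height (h + 2)) = stackSeries h := by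
    rw [hAB, genSeries_congr (a' := profileSum (h + 1)) (b' := height (h + 1))
      (fun _ hn => hn.1.1.profileSum_succ) (fun _ hn => hn.1.1.height_succ (by omega)),
      genSeries_eq_of_bijOn (bijOn_shiftProfile h)]
    exact genSeries_congr (fun _ _ => profileSum_shiftProfile) (fun _ _ => height_shiftProfile hh)
  have gC : genSeries C (profileSum (h + 2)) (height (h + 2)) =
      qVar ^ (h + 1) * tVar ^ 1 * stackSeries (h + 1) := by
    rw [genSeries_eq_of_bijOn (bijOn_raiseProfile h), stackSeries, ← genSeries_add]
    exact genSeries_congr (fun _ _ => profileSum_raiseProfile)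
      (fun _ _ => height_raiseProfile (by omega))
  rw [hABC, hdisj, genSeries_empty, gC] at e2
  rw [gA, gB, gAB] at e1
  rw [stackSeries, ← hS]
  linear_combination e2 + e1

theorem stackSeries_one : stackSeries 1 = 1 := by
  have : stackProfiles 1 = {fun _ => 0} := by
    ext n
    constructor
    · rintro ⟨hn, h0⟩
      funext k
      rcases k with _ | k
      · exact h0
      · exact hn.zero (by omega)
    · rintro rfl
      exact ⟨⟨fun _ => by simp, fun _ _ => by simp, fun _ => rfl⟩, rfl⟩
  rw [stackSeries, this, genSeries_singleton]
  simp [profileSum, height]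

theorem stackSeries_two : stackSeries 2 = 1 + tVar * qVar := by
  have hA : {n ∈ stackProfiles 2 | n 1 = 0} = stackProfiles 1 := setOf_stackProfiles_last 1
  have hC := bijOn_raiseProfile 0
  set C := {n ∈ stackProfiles (0 + 2) | n 1 ≠ 0 ∧ n (0 + 1) ≠ 0} with hCdef
  have hS : stackProfiles 2 = stackProfiles 1 ∪ C := by
    rw [← hA]
    ext n
    constructor
    · intro hn
      by_cases h1 : n 1 = 0
      · exact Or.inl ⟨hn, h1⟩
      · exact Or.inr ⟨hn, h1, h1⟩
    · rintro (hn | hn)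
      · exact hn.1
      · exact hn.1
  have hdisj : stackProfiles 1 ∩ C = ∅ := by
    rw [← hA]
    exact Set.eq_empty_of_forall_notMem fun n hn => hn.2.2.1 hn.1.2
  have e := genSeries_union_add_inter (profileSum 2) (height 2) (finite_isProfile 1 0)
    ((finite_isProfile 2 0).subset fun n (hn : n ∈ C) => hn.1)
  have gC : genSeries C (profileSum 2) (height 2) = qVar ^ 1 * tVar ^ 1 * stackSeries 1 := by
    rw [genSeries_eq_of_bijOn hC, stackSeries, ← genSeries_add]
    exact genSeries_congr (fun _ _ => profileSum_raiseProfile)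
      (fun _ _ => height_raiseProfile (by omega))
  change genSeries (stackProfiles 1 ∪ C) _ _ + genSeries (stackProfiles 1 ∩ C) _ _ =
    genSeries (stackProfiles 1) _ _ + _ at e
  rw [← hS, hdisj, genSeries_empty, gC, genSeries_stackProfiles_succ (by omega),
    stackSeries_one] at e
  rw [stackSeries]
  linear_combination e

/-- The index drops by one because column 0 is empty: only `m` of the `m + 1` columns can carry
cells. -/
theorem stackSeries_eq : ∀ m : ℕ, stackSeries (m + 1) = stackTO tVar qVar m
  | 0 => stackSeries_one
  | 1 => stackSeries_two
  | m + 2 => by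
    rw [stackSeries_succ_succ (Nat.succ_pos m), stackSeries_eq (m + 1), stackSeries_eq m, stackTO]

theorem map_stackTO {R S : Type*} [CommRing R] [CommRing S] (f : R →+* S) (x q : R) :
    ∀ m : ℕ, f (stackTO x q m) = stackTO (f x) (f q) m
  | 0 => by simp [stackTO]
  | 1 => by simp [stackTO]
  | m + 2 => by simp [stackTO, map_ofNat, map_stackTO f x q (m + 1), map_stackTO f x q m]

theorem atSixthPowers_stackTO (m : ℕ) :
    atSixthPowers (stackTO tVar qVar m) = stackTO (tVar ^ 6) (qVar ^ 6) m := by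
  have := map_stackTO (MvPowerSeries.expand 6 (by norm_num) : QTSeries →ₐ[ℤ] QTSeries).toRingHom
    tVar qVar m
  simpa [atSixthPowers, tVar, qVar] using this

end Stacks

/-! ### Directed convex polyominoes without strong decrease. -/

section Directed

variable {h r l : ℕ} {n : ℕ → ℕ} {D : Finset Cell}

/-- The directed convex polyomino with `r` columns whose column sizes, read from the last column,
are given by a profile. -/
def directedPolyomino (r : ℕ) (n : ℕ → ℕ) : Finset Cell :=
  ((Finset.range r).sigma fun i => Finset.range (n (r - 1 - i))).image
    fun a => ((a.1 : ℤ), (a.2 : ℤ))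

theorem mem_directedPolyomino {x y : ℤ} : (x, y) ∈ directedPolyomino r n ↔
    ∃ i b : ℕ, i < r ∧ b < n (r - 1 - i) ∧ x = i ∧ y = b := by
  simp only [directedPolyomino, Finset.mem_image, Finset.mem_sigma, Finset.mem_range,
    Sigma.exists, Prod.mk.injEq]
  constructor
  · rintro ⟨i, b, ⟨h1, h2⟩, rfl, rfl⟩
    exact ⟨i, b, h1, h2, rfl, rfl⟩
  · rintro ⟨i, b, h1, h2, rfl, rfl⟩
    exact ⟨i, b, ⟨h1, h2⟩, rfl, rfl⟩

theorem natCast_mem_directedPolyomino {i b : ℕ} : ((i : ℤ), (b : ℤ)) ∈ directedPolyomino r n ↔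
    i < r ∧ b < n (r - 1 - i) := by
  rw [mem_directedPolyomino]
  constructor
  · rintro ⟨i', b', h1, h2, h3, h4⟩
    obtain rfl : i = i' := by omega
    obtain rfl : b = b' := by omega
    exact ⟨h1, h2⟩
  · rintro ⟨h1, h2⟩
    exact ⟨i, b, h1, h2, rfl, rfl⟩

theorem card_directedPolyomino (r : ℕ) (n : ℕ → ℕ) :
    (directedPolyomino r n).card = profileSum r n := by
  rw [directedPolyomino, Finset.card_image_of_injective, Finset.card_sigma, profileSum]
  · simp only [Finset.card_range]
    exact Finset.sum_range_reflect n r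
  · rintro ⟨i, b⟩ ⟨i', b'⟩ heq
    simp only [Prod.mk.injEq] at heq
    obtain rfl : i = i' := by omega
    obtain rfl : b = b' := by omega
    rfl

theorem colSize_eq {i m : ℕ} (hD : ∀ y : ℤ, ((i : ℤ), y) ∈ D ↔ 0 ≤ y ∧ y < m) :
    colSize D i = m := by
  have : (D.filter fun c => c.1 = (i : ℤ)) = (Finset.range m).image fun b : ℕ => ((i : ℤ), (b : ℤ)) := by
    ext ⟨x, y⟩
    simp only [Finset.mem_filter, Finset.mem_image, Finset.mem_range, Prod.mk.injEq]
    constructor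
    · rintro ⟨hc, rfl⟩
      have := (hD y).mp hc
      exact ⟨y.toNat, by omega, rfl, by omega⟩
    · rintro ⟨b, hb, rfl, rfl⟩
      exact ⟨(hD b).mpr (by omega), rfl⟩
  rw [colSize, this, Finset.card_image_of_injective, Finset.card_range]
  intro a b hab
  simpa using hab

theorem colSize_directedPolyomino {i : ℕ} (hi : i < r) :
    colSize (directedPolyomino r n) i = n (r - 1 - i) := by
  refine colSize_eq fun y => ⟨fun hy => ?_, fun hy => ?_⟩
  · obtain ⟨i', b, -, h2, h3, rfl⟩ := mem_directedPolyomino.mp hy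
    obtain rfl : i = i' := by omega
    omega
  · obtain ⟨b, rfl⟩ := Int.eq_ofNat_of_zero_le hy.1
    rw [natCast_mem_directedPolyomino]
    omega

/-- The profiles with `r` columns, the one on the axis being of size `l`. -/
def columnProfiles (r l : ℕ) : Set (ℕ → ℕ) := {n | IsProfile r n ∧ n 0 = l ∧ ∀ k < r, n k ≠ 0}

/-- Unimodality gives convexity along rows, the step condition convexity along north-west diagonals,
and the full base row connects the columns. -/
theorem isConvexPolyomino_directedPolyomino (hr : 0 < r) (hn : n ∈ columnProfiles r l) :
    IsConvexPolyomino (directedPolyomino r n) := by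
  obtain ⟨hn, -, hpos⟩ := hn
  refine ⟨isPolyomino_of_descent (c := (0, 0)) ?_ (fun c => c.1.natAbs + c.2.natAbs) ?_, ?_, ?_, ?_⟩
  · exact natCast_mem_directedPolyomino.mpr ⟨hr, Nat.pos_of_ne_zero (hpos _ (by omega))⟩
  · rintro ⟨x, y⟩ hc hne
    obtain ⟨i, b, h1, h2, rfl, rfl⟩ := mem_directedPolyomino.mp hc
    rcases b with _ | b
    · rcases i with _ | i
      · exact absurd rfl hne
      · refine ⟨((i : ℤ), ((0 : ℕ) : ℤ)), natCast_mem_directedPolyomino.mpr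
          ⟨by omega, Nat.pos_of_ne_zero (hpos _ (by omega))⟩, ?_, ?_⟩
        · rw [Prod.mk_sub_mk, mk_mem_hexSteps]
          omega
        · simp only
          omega
    · refine ⟨((i : ℤ), (b : ℤ)), natCast_mem_directedPolyomino.mpr ⟨h1, by omega⟩, ?_, ?_⟩
      · rw [Prod.mk_sub_mk, mk_mem_hexSteps]
        omega
      · simp only
        omega
  · refine isConvexAlong_north fun x a y b hay hyb ha hb => ?_
    obtain ⟨i, a, h1, h2, rfl, rfl⟩ := mem_directedPolyomino.mp ha
    obtain ⟨i', b, h3, h4, h5, rfl⟩ := mem_directedPolyomino.mp hb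
    obtain rfl : i = i' := by omega
    lift y to ℕ using by omega
    exact natCast_mem_directedPolyomino.mpr ⟨h1, by omega⟩
  · refine isConvexAlong_northEast fun y a x b hax hxb ha hb => ?_
    obtain ⟨a, j, h1, h2, rfl, rfl⟩ := mem_directedPolyomino.mp ha
    obtain ⟨b, j', h3, h4, rfl, h5⟩ := mem_directedPolyomino.mp hb
    obtain rfl : j = j' := by omega
    lift x to ℕ using by omega
    have := hn.unimodal (show r - 1 - b ≤ r - 1 - x by omega) (show r - 1 - x ≤ r - 1 - a by omega)
    exact natCast_mem_directedPolyomino.mpr ⟨by omega, by omega⟩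
  · refine isConvexAlong_northWest fun s a x b hax hxb ha hb => ?_
    obtain ⟨a, j, h1, h2, rfl, h3⟩ := mem_directedPolyomino.mp ha
    obtain ⟨b, j', h4, h5, rfl, h6⟩ := mem_directedPolyomino.mp hb
    obtain ⟨x, rfl⟩ := Int.eq_ofNat_of_zero_le (show 0 ≤ x by omega)
    obtain ⟨y, hy⟩ := Int.eq_ofNat_of_zero_le (show 0 ≤ s - x by omega)
    rw [hy]
    have := hn.le_add (r - 1 - x) (x - a)
    rw [show r - 1 - x + (x - a) = r - 1 - a by omega] at this
    exact natCast_mem_directedPolyomino.mpr ⟨by omega, by omega⟩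

theorem isDirectedConvex_directedPolyomino (hr : 0 < r) (hn : n ∈ columnProfiles r l) :
    IsDirectedConvex r (directedPolyomino r n) := by
  have e : ∀ i j : ℕ, i • northEast + j • north = ((i : ℤ), (j : ℤ)) := fun i j => by
    simp [northEast, north]
  refine ⟨isConvexPolyomino_directedPolyomino hr hn, fun i hi => ?_, ?_⟩
  · have := e i 0
    rw [zero_smul, add_zero] at this
    rw [this]
    exact natCast_mem_directedPolyomino.mpr ⟨hi, Nat.pos_of_ne_zero (hn.2.2 _ (by omega))⟩
  · rintro ⟨x, y⟩ hc
    obtain ⟨i, b, h1, h2, rfl, rfl⟩ := mem_directedPolyomino.mp hc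
    refine ⟨i, h1, b, (e i b).symm, fun j hj => ?_⟩
    rw [e]
    exact natCast_mem_directedPolyomino.mpr ⟨h1, by omega⟩

/-- The lines met are `r` columns, `height r n` rows and `r - 1 + l` diagonals: by the step
condition no cell lies on a diagonal beyond that of the top of the last column. -/
theorem halfPerimeter_directedPolyomino (hr : 0 < r) (hn : n ∈ columnProfiles r l) :
    halfPerimeter (directedPolyomino r n) = height r n + (2 * r + l - 1) := by
  have hconv := isConvexPolyomino_directedPolyomino hr hn
  obtain ⟨hn, hl, hpos⟩ := hn
  have h1 : (directedPolyomino r n).image Prod.fst = Finset.Ico (0 : ℤ) r := by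
    ext x
    simp only [Finset.mem_image, Prod.exists, exists_and_right, exists_eq_right, Finset.mem_Ico]
    constructor
    · rintro ⟨y, hc⟩
      obtain ⟨i, b, h1, h2, rfl, rfl⟩ := mem_directedPolyomino.mp hc
      omega
    · rintro ⟨h0, h1⟩
      lift x to ℕ using h0
      exact ⟨(0 : ℕ), natCast_mem_directedPolyomino.mpr
        ⟨by omega, Nat.pos_of_ne_zero (hpos _ (by omega))⟩⟩
  have h2 : (directedPolyomino r n).image Prod.snd = Finset.Ico (0 : ℤ) (height r n) := by
    ext y
    simp only [Finset.mem_image, Prod.exists, exists_eq_right, Finset.mem_Ico]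
    constructor
    · rintro ⟨x, hc⟩
      obtain ⟨i, b, h1, h2, rfl, rfl⟩ := mem_directedPolyomino.mp hc
      have := hn.le_height (r - 1 - i)
      omega
    · rintro ⟨h0, h1⟩
      lift y to ℕ using h0
      obtain ⟨k, hk, e⟩ := exists_eq_height hr n
      refine ⟨(r - 1 - k : ℕ), natCast_mem_directedPolyomino.mpr ⟨by omega, ?_⟩⟩
      rw [show r - 1 - (r - 1 - k) = k by omega]
      omega
  have h3 : ((directedPolyomino r n).image fun c => c.1 + c.2) =
      Finset.Ico (0 : ℤ) (r - 1 + l : ℕ) := by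
    ext s
    simp only [Finset.mem_image, Prod.exists, Finset.mem_Ico]
    constructor
    · rintro ⟨x, y, hc, rfl⟩
      obtain ⟨i, b, h1, h2, rfl, rfl⟩ := mem_directedPolyomino.mp hc
      have := hn.le_add 0 (r - 1 - i)
      rw [zero_add, hl] at this
      omega
    · rintro ⟨h0, h1⟩
      lift s to ℕ using h0
      by_cases hs : s < r
      · exact ⟨s, (0 : ℕ), natCast_mem_directedPolyomino.mpr
          ⟨by omega, Nat.pos_of_ne_zero (hpos _ (by omega))⟩, by simp⟩
      · refine ⟨(r - 1 : ℕ), (s - (r - 1) : ℕ), natCast_mem_directedPolyomino.mpr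
          ⟨by omega, ?_⟩, by omega⟩
        rw [Nat.sub_self, hl]
        omega
  rw [halfPerimeter_eq_card_lines hconv.2.1 hconv.2.2.1 hconv.2.2.2, h1, h2, h3]
  simp only [Int.card_Ico]
  omega

theorem lastState_eq_two_iff :
    lastState r D = 2 ↔ ∃ i, i + 1 < r ∧ StrongDecrease D i := by
  unfold lastState
  split_ifs <;> simp_all

theorem lastState_le_two : lastState r D ≤ 2 := by
  unfold lastState
  split_ifs <;> simp

/-- Directedness makes each column an interval starting at its basis cell, so the column sizes
determine the polyomino. -/
theorem IsDirectedConvex.mem_iff (hD : IsDirectedConvex r D) (x y : ℤ) :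
    (x, y) ∈ D ↔ ∃ i b : ℕ, i < r ∧ b < colSize D i ∧ x = i ∧ y = b := by
  have e : ∀ i j : ℕ, i • northEast + j • north = ((i : ℤ), (j : ℤ)) := fun i j => by
    simp [northEast, north]
  have key : ∀ c ∈ D, ∃ i < r, ∃ k : ℕ, c = ((i : ℤ), (k : ℤ)) ∧
      ∀ j ≤ k, ((i : ℤ), (j : ℤ)) ∈ D := by
    intro c hc
    obtain ⟨i, hi, k, h1, h2⟩ := hD.2.2 c hc
    simp only [e] at h1 h2
    exact ⟨i, hi, k, h1, h2⟩
  have col : ∀ i : ℕ, ∀ b : ℕ, ((i : ℤ), (b : ℤ)) ∈ D ↔ b < colSize D i := by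
    intro i
    obtain ⟨m, hm⟩ := exists_forall_mem_iff_lt (P := D) (f := fun b : ℕ => ((i : ℤ), (b : ℤ)))
      (fun a b hab => by simpa using hab) (fun a b hab hb => by
        obtain ⟨i', -, k, h1, h2⟩ := key _ hb
        simp only [Prod.mk.injEq] at h1
        have := h2 a (by omega)
        rwa [← h1.1] at this)
    have : colSize D i = m := colSize_eq fun y => by
      constructor
      · intro hy
        obtain ⟨i', -, k, h1, -⟩ := key _ hy
        simp only [Prod.mk.injEq] at h1
        obtain rfl := h1.2
        have := (hm k).mp hy
        omega
      · rintro ⟨h1, h2⟩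
        lift y to ℕ using h1
        exact (hm y).mpr (by omega)
    rw [this]
    exact hm
  constructor
  · intro hc
    obtain ⟨i, hi, k, h1, -⟩ := key _ hc
    simp only [Prod.mk.injEq] at h1
    obtain ⟨rfl, rfl⟩ := h1
    exact ⟨i, k, hi, (col i k).mp hc, rfl, rfl⟩
  · rintro ⟨i, b, -, h2, rfl, rfl⟩
    exact (col i b).mpr h2

/-- Directed convex polyominoes without strong decrease. -/
def gentleDirectedConvex (r l : ℕ) : Set (Finset Cell) :=
  directedConvex 0 r l ∪ directedConvex 1 r l

theorem mem_gentleDirectedConvex : D ∈ gentleDirectedConvex r l ↔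
    IsDirectedConvex r D ∧ colSize D (r - 1) = l ∧ ∀ i, i + 1 < r → ¬StrongDecrease D i := by
  have h2 := lastState_eq_two_iff (r := r) (D := D)
  have h3 := lastState_le_two (r := r) (D := D)
  constructor
  · rintro (⟨hD, hl, hs⟩ | ⟨hD, hl, hs⟩)
    · exact ⟨hD, hl, fun i hi hd => by have := h2.mpr ⟨i, hi, hd⟩; omega⟩
    · exact ⟨hD, hl, fun i hi hd => by have := h2.mpr ⟨i, hi, hd⟩; omega⟩
  · rintro ⟨hD, hl, hs⟩
    have h4 : lastState r D ≠ 2 := fun h => by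
      obtain ⟨i, hi, hd⟩ := h2.mp h
      exact hs i hi hd
    by_cases h0 : lastState r D = 0
    · exact Or.inl ⟨hD, hl, h0⟩
    · exact Or.inr ⟨hD, hl, by omega⟩

/-- The level changes by one plus twice the variation of the column size, so the absence of strong
decreases means that sizes drop by at most one at a time. Read from the last column, this is the
step condition; convexity along rows gives unimodality. -/
theorem bijOn_directedPolyomino (hr : 0 < r) :
    Set.BijOn (directedPolyomino r) (columnProfiles r l) (gentleDirectedConvex r l) := by
  refine ⟨fun n hn => ?_, ?_, fun D hD => ?_⟩
  · refine mem_gentleDirectedConvex.mpr ⟨isDirectedConvex_directedPolyomino hr hn, ?_, ?_⟩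
    · rw [colSize_directedPolyomino (by omega), Nat.sub_self, hn.2.1]
    · intro i hi
      rw [StrongDecrease, level, level, colSize_directedPolyomino hi,
        colSize_directedPolyomino (by omega)]
      have := hn.1.step (r - 1 - (i + 1))
      rw [show r - 1 - (i + 1) + 1 = r - 1 - i by omega] at this
      push_cast
      omega
  · rintro n ⟨hn, -⟩ n' ⟨hn', -⟩ heq
    funext k
    by_cases hk : k < r
    · have h1 := colSize_directedPolyomino (n := n) (show r - 1 - k < r by omega)
      rw [heq, colSize_directedPolyomino (by omega), show r - 1 - (r - 1 - k) = k by omega] at h1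
      exact h1.symm
    · rw [hn.zero (by omega), hn'.zero (by omega)]
  · obtain ⟨hD, hl, hs⟩ := mem_gentleDirectedConvex.mp hD
    have hmem : ∀ i b : ℕ, ((i : ℤ), (b : ℤ)) ∈ D ↔ i < r ∧ b < colSize D i := fun i b => by
      rw [hD.mem_iff]
      constructor
      · rintro ⟨i', b', h1, h2, h3, h4⟩
        obtain rfl : i = i' := by omega
        obtain rfl : b = b' := by omega
        exact ⟨h1, h2⟩
      · rintro ⟨h1, h2⟩
        exact ⟨i, b, h1, h2, rfl, rfl⟩
    let n : ℕ → ℕ := fun k => if k < r then colSize D (r - 1 - k) else 0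
    have hnlt : ∀ k < r, n k = colSize D (r - 1 - k) := fun k hk => if_pos hk
    have hnge : ∀ k, r ≤ k → n k = 0 := fun k hk => if_neg (by omega)
    refine ⟨n, ⟨⟨fun k => ?_, fun {i j k} hij hjk => ?_, fun {k} hk => hnge k hk⟩, ?_, fun k hk => ?_⟩,
      ?_⟩
    · by_cases hk : k + 1 < r
      · have := hs (r - 1 - (k + 1)) (by omega)
        rw [StrongDecrease, level, level] at this
        rw [hnlt _ hk, hnlt k (by omega)]
        rw [show r - 1 - (k + 1) + 1 = r - 1 - k by omega] at this
        omega
      · rw [hnge _ (by omega)]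
        omega
    · by_cases hk : k < r
      · by_contra! hcon
        rw [hnlt i (by omega), hnlt j (by omega), hnlt k hk] at hcon
        have h1 := (hmem (r - 1 - i) (colSize D (r - 1 - j))).mpr ⟨by omega, by omega⟩
        have h2 := (hmem (r - 1 - k) (colSize D (r - 1 - j))).mpr ⟨by omega, by omega⟩
        have h3 := hD.1.2.2.1.northEast_mem (x := (r - 1 - j : ℕ)) h2 h1 (by omega) (by omega)
        rw [hmem] at h3
        omega
      · rw [hnge k (by omega)]
        omega
    · rw [hnlt 0 hr, Nat.sub_zero, hl]
    · have h1 := hD.2.1 (r - 1 - k) (by omega)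
      have e : (r - 1 - k) • northEast = (((r - 1 - k : ℕ) : ℤ), ((0 : ℕ) : ℤ)) := by
        simp [northEast]
      rw [e, hmem] at h1
      rw [hnlt k hk]
      omega
    · ext ⟨x, y⟩
      rw [mem_directedPolyomino, hD.mem_iff]
      refine exists_congr fun i => exists_congr fun b => and_congr_right fun hi => ?_
      rw [hnlt _ (by omega), show r - 1 - (r - 1 - i) = i by omega]

end Directed

/-! ### The terms of `R₁` and `R₃` as series of symmetric polyominoes. -/

section SeriesOfDirected

variable {h r l : ℕ}

theorem finite_columnProfiles (r l : ℕ) : (columnProfiles r l).Finite :=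
  (finite_isProfile r l).subset fun _ hn => ⟨hn.1, hn.2.1⟩

theorem le_halfPerimeter_of_mem (hr : 0 < r) {D : Finset Cell} (hD : D ∈ gentleDirectedConvex r l) :
    2 * r + l - 1 ≤ halfPerimeter D := by
  obtain ⟨n, hn, rfl⟩ := (bijOn_directedPolyomino hr).surjOn hD
  rw [halfPerimeter_directedPolyomino hr hn]
  omega

theorem directedConvex_subset {i : ℕ} (hi : i < 2) :
    directedConvex i r l ⊆ gentleDirectedConvex r l := by
  obtain rfl | rfl : i = 0 ∨ i = 1 := by omega
  · exact Set.subset_union_left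
  · exact Set.subset_union_right

theorem tVar_pow_dvd_seriesDC {i : ℕ} (hi : i < 2) (hr : 0 < r) :
    tVar ^ (2 * r + l - 1) ∣ seriesDC i r l := by
  have := dvd_genSeries (S := directedConvex i r l) (a := Finset.card) (A := 0)
    (fun _ _ => Nat.zero_le _)
    (fun D hD => le_halfPerimeter_of_mem hr (directedConvex_subset hi hD))
  rwa [pow_zero, one_mul] at this

/-- States 0 and 1 together mean the absence of strong decreases, and dividing by `t ^ (2 * r + l -
1)` leaves only the number of rows as exponent. -/
theorem seriesDC01_eq (hr : 0 < r) : seriesDC01 r l =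
    genSeries (columnProfiles r l) (fun n => 6 * profileSum r n) (fun n => 6 * height r n) := by
  have hbij := bijOn_directedPolyomino (l := l) hr
  have hfin : (gentleDirectedConvex r l).Finite :=
    hbij.image_eq ▸ (finite_columnProfiles r l).image _
  have e : ∀ i < 2, atSixthPowers (normSeriesDC i r l) = genSeries (directedConvex i r l)
      (fun D => 6 * D.card) (fun D => 6 * (halfPerimeter D - (2 * r + l - 1))) := fun i hi => by
    rw [normSeriesDC, seriesDC, divMonomial_genSeries (fun _ _ => Nat.zero_le _)
      (fun D hD => le_halfPerimeter_of_mem hr (directedConvex_subset hi hD)),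
      atSixthPowers_genSeries]
    rfl
  have hdisj : directedConvex 0 r l ∩ directedConvex 1 r l = ∅ := by
    refine Set.eq_empty_of_forall_notMem fun D hD => ?_
    have h0 : lastState r D = 0 := hD.1.2.2
    have h1 : lastState r D = 1 := hD.2.2.2
    omega
  have hu := genSeries_union_add_inter (fun D : Finset Cell => 6 * D.card)
    (fun D => 6 * (halfPerimeter D - (2 * r + l - 1)))
    (hfin.subset (directedConvex_subset (i := 0) (by omega)))
    (hfin.subset (directedConvex_subset (i := 1) (by omega)))
  rw [hdisj, genSeries_empty, add_zero] at hu
  rw [seriesDC01, e 0 (by omega), e 1 (by omega), ← hu]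
  rw [show directedConvex 0 r l ∪ directedConvex 1 r l = gentleDirectedConvex r l from rfl,
    genSeries_eq_of_bijOn hbij]
  refine genSeries_congr (fun n _ => ?_) (fun n hn => ?_)
  · rw [card_directedPolyomino]
  · rw [halfPerimeter_directedPolyomino hr hn, Nat.add_sub_cancel]

theorem le_profileSum (hh : 0 < h) (n : ℕ → ℕ) : n 0 ≤ profileSum h n :=
  Finset.single_le_sum (f := n) (fun _ _ => Nat.zero_le _) (Finset.mem_range.mpr hh)

theorem qVar_pow_dvd_seriesDC01 (hr : 0 < r) : qVar ^ (3 * l) ∣ seriesDC01 r l := by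
  rw [seriesDC01_eq hr]
  have := dvd_genSeries (S := columnProfiles r l) (a := fun n => 6 * profileSum r n)
    (b := fun n => 6 * height r n) (A := 3 * l) (B := 0) (fun n hn => by
      have := le_profileSum hr n
      rw [hn.2.1] at this
      omega) (fun _ _ => Nat.zero_le _)
  rwa [pow_zero, mul_one] at this

/-- The sixfold area counts the axis column six times, whereas only three copies of it occur in the
symmetric polyomino. The subtraction does not truncate, as `l ≤ profileSum r n`. -/
theorem divMonomial_seriesDC01 (hr : 0 < r) : divMonomial (3 * l) 0 (seriesDC01 r l) =
    genSeries (columnProfiles r l) (fun n => 6 * profileSum r n - 3 * l)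
      (fun n => 6 * height r n) := by
  rw [seriesDC01_eq hr, divMonomial_genSeries (fun n hn => ?_) (fun _ _ => Nat.zero_le _)]
  · rfl
  · have := le_profileSum hr n
    rw [hn.2.1] at this
    omega

theorem IsProfile.profileSum_of_le {n : ℕ → ℕ} (hn : IsProfile r n) (hrh : r ≤ h) :
    profileSum h n = profileSum r n := by
  refine (Finset.sum_subset (Finset.range_subset_range.mpr hrh) fun k _ hk => ?_).symm
  exact hn.zero (by simpa using hk)

theorem IsProfile.height_of_le {n : ℕ → ℕ} (hn : IsProfile r n) (hr : 0 < r) (hrh : r ≤ h) :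
    height h n = height r n := by
  refine height_eq (fun k _ => hn.le_height k) ?_
  obtain ⟨k, hk, e⟩ := exists_eq_height hr n
  exact ⟨k, by omega, e⟩

/-- Here `r` is the first zero of `n`: since `n 0 > 0`, unimodality makes `n` vanish from there on.
-/
theorem isProfile_eq_iUnion_columnProfiles (hl : 0 < l) :
    {n | IsProfile h n ∧ n 0 = l} = ⋃ r ∈ Finset.Icc 1 h, columnProfiles r l := by
  classical
  ext n
  simp only [Set.mem_iUnion, Finset.mem_Icc, exists_prop]
  constructor
  · rintro ⟨hn, h0⟩
    have hex : ∃ k, n k = 0 := ⟨h, hn.zero le_rfl⟩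
    have hz := Nat.find_spec hex
    have hne : Nat.find hex ≠ 0 := fun h => by
      rw [h, h0] at hz
      omega
    refine ⟨Nat.find hex, ⟨Nat.one_le_iff_ne_zero.mpr hne, Nat.find_min' hex (hn.zero le_rfl)⟩,
      ⟨hn.step, hn.unimodal, fun {k} hk => ?_⟩, h0, fun k hk => Nat.find_min hex hk⟩
    have := hn.unimodal (Nat.zero_le _) hk
    omega
  · rintro ⟨r, ⟨-, hrh⟩, hn, h0, -⟩
    exact ⟨⟨hn.step, hn.unimodal, fun hk => hn.zero (hrh.trans hk)⟩, h0⟩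

theorem sum_divMonomial_seriesDC01 (hl : 0 < l) :
    ∑ r ∈ Finset.Icc 1 h, divMonomial (3 * l) 0 (seriesDC01 r l) =
      genSeries {n | IsProfile h n ∧ n 0 = l} (fun n => 6 * profileSum h n - 3 * l)
        (fun n => 6 * height h n) := by
  rw [genSeries_biUnion (Finset.Icc 1 h) _ _ (finite_isProfile h l)
    (isProfile_eq_iUnion_columnProfiles hl)]
  · refine Finset.sum_congr rfl fun r hr => ?_
    obtain ⟨hr, hrh⟩ := Finset.mem_Icc.mp hr
    rw [divMonomial_seriesDC01 hr]
    refine genSeries_congr (fun n hn => ?_) (fun n hn => ?_)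
    · rw [hn.1.profileSum_of_le hrh]
    · rw [hn.1.height_of_le hr hrh]
  · intro i j n hi hj
    by_contra hij
    rcases Nat.lt_or_gt_of_ne hij with hlt | hlt
    · exact hj.2.2 i hlt (hi.1.zero le_rfl)
    · exact hi.2.2 j hlt (hj.1.zero le_rfl)

/-- The symmetric convex polyominoes with given extents. -/
def symmetricWithExtents (h l : ℕ) : Set (Finset Cell) :=
  {P | IsSymmetricConvex P ∧ extent northEast P = h ∧ extent north P = h + l}

theorem bijOn_symmetricPolyomino (hh : 0 < h) :
    Set.BijOn (symmetricPolyomino h) {n | IsProfile h n ∧ n 0 = l} (symmetricWithExtents h l) := by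
  refine ⟨?_, symmetricPolyomino_injOn.mono fun n hn => hn.1, ?_⟩
  · rintro n ⟨hn, rfl⟩
    exact ⟨hn.isSymmetricConvex hh, hn.extent_northEast, hn.extent_north⟩
  · rintro P ⟨hP, h1, h2⟩
    obtain ⟨n, hn, rfl⟩ := hP.exists_profile h1 (by omega)
    refine ⟨n, ⟨hn, ?_⟩, rfl⟩
    rw [hn.extent_north] at h2
    omega

theorem genSeries_symmetricWithExtents (hh : 0 < h) :
    genSeries (symmetricWithExtents h l) Finset.card halfPerimeter = superHexagon h *
      genSeries {n | IsProfile h n ∧ n 0 = l} (fun n => 6 * profileSum h n - 3 * l)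
        (fun n => 6 * height h n) := by
  rw [superHexagon, mul_comm (tVar ^ _), ← genSeries_add,
    genSeries_eq_of_bijOn (bijOn_symmetricPolyomino hh)]
  refine genSeries_congr ?_ ?_
  · rintro n ⟨hn, rfl⟩
    have h1 := hn.card_symmetricPolyomino hh
    have h2 := le_profileSum hh n
    rw [profileSum] at h2 ⊢
    omega
  · rintro n ⟨hn, -⟩
    exact hn.halfPerimeter_symmetricPolyomino hh

theorem termR1_eq (hh : 0 < h) (hl : 0 < l) :
    termR1 h l = genSeries (symmetricWithExtents h l) Finset.card halfPerimeter := by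
  rw [genSeries_symmetricWithExtents hh, termR1, sum_divMonomial_seriesDC01 hl]

theorem termR3_eq (hh : 0 < h) :
    termR3 h = genSeries (symmetricWithExtents h 0) Finset.card halfPerimeter := by
  obtain ⟨m, rfl⟩ := Nat.exists_eq_succ_of_ne_zero hh.ne'
  rw [genSeries_symmetricWithExtents hh, termR3, Nat.succ_sub_one, ← atSixthPowers_stackTO,
    ← stackSeries_eq, stackSeries, atSixthPowers_genSeries]
  rfl

end SeriesOfDirected

/-! ### The centre of symmetry and the symmetric representative of a class. -/

section Centre

variable {P Q : Finset Cell}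

theorem IsPolyomino.of_equiv (hP : IsPolyomino P) (e : Cell ≃ Cell)
    (he : ∀ a b, e b - e a ∈ hexSteps ↔ b - a ∈ hexSteps) (hQ : ∀ c, e c ∈ Q ↔ c ∈ P) :
    IsPolyomino Q := by
  let φ : hexGraph.induce (P : Set Cell) ≃g hexGraph.induce (Q : Set Cell) :=
    { toEquiv := e.subtypeEquiv fun c => (hQ c).symm
      map_rel_iff' := fun {a b} => he a.1 b.1 }
  exact φ.connected_iff.mp hP

theorem IsConvexAlong.shift {d : Cell} (h : IsConvexAlong d P) (u : Cell) :
    IsConvexAlong d (shift u P) := by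
  intro c hc n hn k hk
  rw [mem_shift] at hc hn ⊢
  rw [add_sub_right_comm] at hn ⊢
  exact h _ hc n hn k hk

theorem IsConvexPolyomino.shift (h : IsConvexPolyomino P) (u : Cell) :
    IsConvexPolyomino (shift u P) := by
  refine ⟨h.1.of_equiv (Equiv.addRight u) (fun a b => ?_) (fun c => ?_), h.2.1.shift u,
    h.2.2.1.shift u, h.2.2.2.shift u⟩
  · simp
  · simp [mem_shift]

theorem shift_shift (u w : Cell) : shift u (shift w P) = shift (w + u) P := by
  ext c
  simp only [mem_shift]
  rw [sub_sub, add_comm]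

theorem shift_zero : shift 0 P = P := by
  ext c
  simp [mem_shift]

theorem card_transform (g : LatticeAut) : (transform g P).card = P.card := Finset.card_map _

theorem sum_shift (u : Cell) : ∑ c ∈ shift u P, c = ∑ c ∈ P, c + P.card • u := by
  rw [shift, Finset.sum_map]
  simp [Finset.sum_add_distrib]

theorem sum_transform (g : LatticeAut) : ∑ c ∈ transform g P, c = g (∑ c ∈ P, c) := by
  rw [transform, Finset.sum_map, map_sum]
  rfl

theorem transform_shift (g : LatticeAut) (u : Cell) :
    transform g (shift u P) = shift (g u) (transform g P) := by
  ext c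
  simp [mem_shift, mem_transform]

theorem transform_eq_of_forall_mem {g : LatticeAut} (h : ∀ c ∈ P, g c ∈ P) : transform g P = P := by
  refine Finset.eq_of_subset_of_card_le (fun c hc => ?_) (card_transform g).ge
  rw [mem_transform] at hc
  simpa using h _ hc

theorem rot_sq_apply (x y : ℤ) : (rot ^ 2) (x, y) = (y, -x - y) := by
  rw [pow_two]
  change ((x + y + -x, -(x + y)) : Cell) = _
  ext
  · simp
  · simp only
    ring

theorem vert_apply (x y : ℤ) : vert (x, y) = (-x, x + y) := rfl

theorem rot_sq_mem : rot ^ 2 ∈ groupH31 := Subgroup.subset_closure (Set.mem_insert _ _)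

theorem vert_mem : vert ∈ groupH31 := Subgroup.subset_closure (Set.mem_insert_of_mem _ rfl)

/-- Invariance under `H_{3,1}` is invariance under its generators. -/
theorem isSymmetricConvex_iff : IsSymmetricConvex P ↔
    IsConvexPolyomino P ∧ ∀ g ∈ groupH31, transform g P = P := by
  constructor
  · intro hP
    refine ⟨hP.convex, fun g hg => ?_⟩
    induction hg using Subgroup.closure_induction with
    | mem g hg =>
      rcases hg with rfl | rfl
      · refine transform_eq_of_forall_mem ?_
        rintro ⟨x, y⟩ hc
        rw [rot_sq_apply]
        exact hP.rot_mem hc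
      · refine transform_eq_of_forall_mem ?_
        rintro ⟨x, y⟩ hc
        rw [vert_apply]
        exact hP.vert_mem hc
    | one =>
      ext c
      rw [mem_transform]
      rfl
    | mul g g' _ _ h h' =>
      ext c
      conv_rhs => rw [← h, mem_transform, ← h', mem_transform]
      rw [mem_transform]
      rfl
    | inv g _ h =>
      ext c
      rw [mem_transform]
      conv_rhs => rw [← LinearEquiv.symm_apply_apply g c, ← mem_transform, h]
      rfl
  · rintro ⟨hP, h⟩
    refine ⟨hP, fun {x y} hc => ?_, fun {x y} hc => ?_⟩
    · rw [← h _ rot_sq_mem, ← rot_sq_apply, mem_transform, LinearEquiv.symm_apply_apply]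
      exact hc
    · rw [← h _ vert_mem, ← vert_apply, mem_transform, LinearEquiv.symm_apply_apply]
      exact hc

/-- The sum is fixed by the rotation, which fixes only 0. This normalisation singles out one
translate in each class. -/
theorem IsSymmetricConvex.sum_eq_zero (hP : IsSymmetricConvex P) : ∑ c ∈ P, c = 0 := by
  have h := sum_transform (P := P) (rot ^ 2)
  rw [(isSymmetricConvex_iff.mp hP).2 _ rot_sq_mem] at h
  generalize ∑ c ∈ P, c = S at h ⊢
  obtain ⟨X, Y⟩ := S
  rw [rot_sq_apply, Prod.mk.injEq] at h
  rw [← Prod.mk_zero_zero, Prod.mk.injEq]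
  omega

/-- The centre of symmetry of a polyomino invariant under `H_{3,1}` up to translation is the centre
of a cell. -/
theorem exists_isSymmetricConvex_shift (hP : IsConvexPolyomino P)
    (hfix : TransClass.mk P ∈ fixClasses groupH31) : ∃ c, IsSymmetricConvex (shift (-c) P) := by
  have hu : ∀ g ∈ groupH31, ∃ u, P = shift u (transform g P) := fun g hg =>
    Quotient.exact (s := translationSetoid) (hfix.2 g hg)
  have hsum : ∀ g : LatticeAut, ∀ u, P = shift u (transform g P) →
      ∑ c ∈ P, c = g (∑ c ∈ P, c) + P.card • u := fun g u h => by
    conv_lhs => rw [h, sum_shift, sum_transform, card_transform]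
  have hpos : (P.card : ℤ) ≠ 0 := by
    obtain ⟨⟨c, hc⟩⟩ := hP.1.nonempty
    exact_mod_cast Finset.card_ne_zero_of_mem hc
  -- For the sum `(X, Y)`, the rotation makes `X - Y` a multiple of the area and the reflection
  -- makes `X` one. The rotation alone would allow a vertex of the lattice as centre.
  obtain ⟨c, hc⟩ : ∃ c : Cell, ∑ a ∈ P, a = P.card • c := by
    obtain ⟨⟨u1, u2⟩, h1⟩ := hu _ rot_sq_mem
    obtain ⟨⟨w1, w2⟩, h2⟩ := hu _ vert_mem
    replace h1 := hsum _ _ h1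
    replace h2 := hsum _ _ h2
    refine ⟨(-w2, -w2 - u1), ?_⟩
    generalize ∑ a ∈ P, a = S at h1 h2 ⊢
    obtain ⟨X, Y⟩ := S
    rw [rot_sq_apply] at h1
    rw [vert_apply] at h2
    simp only [Prod.smul_mk, Prod.mk_add_mk, Prod.mk.injEq, nsmul_eq_mul] at h1 h2 ⊢
    constructor
    · linear_combination -h2.2
    · linear_combination -h1.1 - h2.2
  refine ⟨c, isSymmetricConvex_iff.mpr ⟨hP.shift _, fun g hg => ?_⟩⟩
  obtain ⟨u, hu⟩ := hu g hg
  have h1 := hsum g u hu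
  rw [hc, map_nsmul, ← nsmul_add] at h1
  -- Dividing by the area, `u` is the translation bringing the centroid `g c` of the image back to
  -- `c`.
  have h2 : c = g c + u := by
    rw [← Nat.cast_smul_eq_nsmul ℤ, ← Nat.cast_smul_eq_nsmul ℤ] at h1
    exact smul_right_injective Cell hpos h1
  rw [transform_shift]
  conv_rhs => rw [hu, shift_shift]
  congr 1
  rw [map_neg]
  nth_rewrite 2 [h2]
  abel

/-- Uniqueness: recentring at any such cell makes the sum of the cells zero, which determines the
cell because the area is nonzero. -/
theorem existsUnique_centre (hP : IsConvexPolyomino P)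
    (hfix : TransClass.mk P ∈ fixClasses groupH31) :
    ∃! c : Cell, c ∈ P ∧ ∀ g ∈ groupH31, shift c (transform g (shift (-c) P)) = P := by
  obtain ⟨c, hc⟩ := exists_isSymmetricConvex_shift hP hfix
  have hback : ∀ d, shift d (shift (-d) P) = P := fun d => by
    rw [shift_shift, neg_add_cancel, shift_zero]
  refine ⟨c, ⟨?_, fun g hg => ?_⟩, fun d hd => ?_⟩
  · have := hc.zero_mem
    rw [mem_shift, Prod.mk_zero_zero] at this
    simpa using this
  · rw [(isSymmetricConvex_iff.mp hc).2 g hg, hback]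
  · have hd' : IsSymmetricConvex (shift (-d) P) := by
      refine isSymmetricConvex_iff.mpr ⟨hP.shift _, fun g hg => ?_⟩
      have := congrArg (shift (-d)) (hd.2 g hg)
      rwa [shift_shift, add_neg_cancel, shift_zero] at this
    have h1 := hc.sum_eq_zero
    have h2 := hd'.sum_eq_zero
    rw [sum_shift] at h1 h2
    have hpos : (P.card : ℤ) ≠ 0 := by exact_mod_cast Finset.card_ne_zero_of_mem hd.1
    have h3 : (P.card : ℤ) • (-d) = (P.card : ℤ) • (-c) := by
      rw [Nat.cast_smul_eq_nsmul, Nat.cast_smul_eq_nsmul]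
      exact add_left_cancel (h2.trans h1.symm)
    exact neg_injective (smul_right_injective Cell hpos h3)

theorem mk_injOn_isSymmetricConvex : Set.InjOn TransClass.mk {P | IsSymmetricConvex P} := by
  intro P hP Q hQ heq
  obtain ⟨u, hu⟩ : ∃ u, Q = shift u P := Quotient.exact (s := translationSetoid) heq
  have hP : IsSymmetricConvex P := hP
  have hQ : IsSymmetricConvex Q := hQ
  have h1 := hQ.sum_eq_zero
  rw [hu, sum_shift, hP.sum_eq_zero, zero_add, ← Nat.cast_smul_eq_nsmul ℤ, smul_eq_zero] at h1
  have hpos : (P.card : ℤ) ≠ 0 := by exact_mod_cast Finset.card_ne_zero_of_mem hP.zero_mem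
  rw [hu, h1.resolve_left hpos, shift_zero]

theorem mk_shift (u : Cell) : TransClass.mk (shift u P) = TransClass.mk P :=
  (Quotient.sound (s := translationSetoid) ⟨u, rfl⟩).symm

theorem IsSymmetricConvex.mk_mem_fixClasses (hP : IsSymmetricConvex P) :
    TransClass.mk P ∈ fixClasses groupH31 := by
  refine ⟨⟨P, hP.convex, rfl⟩, fun g hg => ?_⟩
  change TransClass.mk (transform g P) = _
  rw [(isSymmetricConvex_iff.mp hP).2 g hg]

theorem bijOn_mk_fixClasses :
    Set.BijOn TransClass.mk {P | IsSymmetricConvex P} (fixClasses groupH31) := by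
  refine ⟨fun P hP => IsSymmetricConvex.mk_mem_fixClasses hP, mk_injOn_isSymmetricConvex, ?_⟩
  intro s hs
  obtain ⟨P, hP, rfl⟩ := hs.1
  obtain ⟨c, hc⟩ := exists_isSymmetricConvex_shift hP hs
  exact ⟨_, hc, mk_shift _⟩

theorem bijOn_mk_fixH31Subclass (rel : ℕ → ℕ → Prop) : Set.BijOn TransClass.mk
    {P | IsSymmetricConvex P ∧ rel (extent north P) (extent northEast P)}
    (fixH31Subclass rel) := by
  refine ⟨?_, mk_injOn_isSymmetricConvex.mono fun P hP => hP.1, ?_⟩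
  · rintro P ⟨hP, h⟩
    exact ⟨hP.mk_mem_fixClasses, P, rfl, (isSymmetricConvex_iff.mp hP).2, h⟩
  · rintro s ⟨hs, P, rfl, hinv, h⟩
    obtain ⟨Q, hQ, heq⟩ := hs.1
    obtain ⟨u, rfl⟩ : ∃ u, P = shift u Q := Quotient.exact (s := translationSetoid) heq
    exact ⟨_, ⟨isSymmetricConvex_iff.mpr ⟨hQ.shift u, hinv⟩, h⟩, rfl⟩

theorem finite_isSymmetricConvex_card (m : ℕ) :
    {P ∈ {P | IsSymmetricConvex P} | P.card = m}.Finite := by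
  refine Set.Finite.of_injOn (f := TransClass.mk) (t := {s ∈ convexClasses | s.area = m}) ?_
    (mk_injOn_isSymmetricConvex.mono fun P hP => hP.1) (finite_convexClasses_area m)
  rintro P ⟨hP, hm⟩
  exact ⟨⟨P, hP.convex, rfl⟩, hm⟩

end Centre

/-! ### The reflection exchanging the two extents. -/

section Swap

variable {P : Finset Cell}

/-- The image under the reflection exchanging the directions north and north-east. -/
def swapCells (P : Finset Cell) : Finset Cell := P.map (Equiv.prodComm ℤ ℤ).toEmbedding

theorem mem_swapCells {x y : ℤ} : (x, y) ∈ swapCells P ↔ (y, x) ∈ P := by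
  rw [swapCells, Finset.mem_map_equiv]
  rfl

theorem swapCells_swapCells : swapCells (swapCells P) = P := by
  ext ⟨x, y⟩
  rw [mem_swapCells, mem_swapCells]

/-- This reflection normalises the group, exchanges columns with rows and preserves each north-west
diagonal. -/
theorem IsSymmetricConvex.swapCells (hP : IsSymmetricConvex P) :
    IsSymmetricConvex (swapCells P) := by
  refine ⟨⟨hP.convex.1.of_equiv (Equiv.prodComm ℤ ℤ) ?_ ?_, ?_, ?_, ?_⟩, ?_, ?_⟩
  · rintro ⟨x, y⟩ ⟨x', y'⟩
    change ((y' - y, x' - x) : Cell) ∈ hexSteps ↔ ((x' - x, y' - y) : Cell) ∈ hexSteps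
    rw [mk_mem_hexSteps, mk_mem_hexSteps]
    omega
  · rintro ⟨x, y⟩
    exact mem_swapCells
  · refine isConvexAlong_north fun x a y b hay hyb ha hb => ?_
    rw [mem_swapCells] at ha hb ⊢
    exact hP.convex.2.2.1.northEast_mem ha hb hay hyb
  · refine isConvexAlong_northEast fun y a x b hax hxb ha hb => ?_
    rw [mem_swapCells] at ha hb ⊢
    exact hP.convex.2.1.north_mem ha hb hax hxb
  · refine isConvexAlong_northWest fun s a x b hax hxb ha hb => ?_
    rw [mem_swapCells] at ha hb ⊢
    exact hP.convex.2.2.2.northWest_mem (s := s) (a := s - b) (b := s - a) (by simpa using hb)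
      (by simpa using ha) (by omega) (by omega) (by omega)
  · intro x y hc
    rw [mem_swapCells] at hc ⊢
    have := hP.rot_mem (hP.rot_mem hc)
    convert this using 2 <;> ring
  · intro x y hc
    rw [mem_swapCells] at hc ⊢
    have := hP.rot_mem (hP.vert_mem hc)
    convert this using 2 <;> ring

theorem IsSymmetricConvex.extent_swapCells (hP : IsSymmetricConvex P) :
    extent north (_root_.swapCells P) = extent northEast P ∧
      extent northEast (_root_.swapCells P) = extent north P := by
  constructor
  · refine extent_eq (by decide) fun k => ?_
    rw [← hP.northEast_mem_iff, ← mem_swapCells (P := P)]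
    simp [north]
  · refine extent_eq (by decide) fun k => ?_
    rw [← hP.north_mem_iff, ← mem_swapCells (P := P)]
    simp [northEast]

theorem IsSymmetricConvex.halfPerimeter_swapCells (hP : IsSymmetricConvex P) :
    halfPerimeter (_root_.swapCells P) = halfPerimeter P := by
  rw [hP.swapCells.halfPerimeter_eq, hP.halfPerimeter_eq, ← hP.image_fst]
  congr 2
  ext a
  simp only [Finset.mem_image, Prod.exists, exists_and_right, exists_eq_right, mem_swapCells]

theorem bijOn_swapCells : Set.BijOn swapCells
    {P | IsSymmetricConvex P ∧ extent north P > extent northEast P}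
    {P | IsSymmetricConvex P ∧ extent north P < extent northEast P} := by
  refine ⟨?_, fun P _ Q _ h => ?_, ?_⟩
  · rintro P ⟨hP, h⟩
    refine ⟨hP.swapCells, ?_⟩
    rwa [hP.extent_swapCells.1, hP.extent_swapCells.2]
  · rw [← swapCells_swapCells (P := P), h, swapCells_swapCells]
  · rintro P ⟨hP, h⟩
    refine ⟨swapCells P, ⟨hP.swapCells, ?_⟩, swapCells_swapCells⟩
    rwa [hP.extent_swapCells.1, hP.extent_swapCells.2]

end Swap

/-! ### Summation over the extents and conclusion. -/

section Convergence

open scoped MvPowerSeries.WithPiTopology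

theorem genSeries_fixH31Subclass (rel : ℕ → ℕ → Prop) :
    genSeries (fixH31Subclass rel) TransClass.area TransClass.halfPerim =
      genSeries {P | IsSymmetricConvex P ∧ rel (extent north P) (extent northEast P)}
        Finset.card halfPerimeter :=
  genSeries_eq_of_bijOn (bijOn_mk_fixH31Subclass rel) _ _

theorem genSeries_fixClasses :
    genSeries (fixClasses groupH31) TransClass.area TransClass.halfPerim =
      genSeries {P | IsSymmetricConvex P} Finset.card halfPerimeter :=
  genSeries_eq_of_bijOn bijOn_mk_fixClasses _ _

theorem finite_sep_isSymmetricConvex {S : Set (Finset Cell)} (hS : ∀ P ∈ S, IsSymmetricConvex P)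
    (m : ℕ) : {P ∈ S | P.card = m}.Finite :=
  (finite_isSymmetricConvex_card m).subset fun P hP => ⟨hS P hP.1, hP.2⟩

/-- The terms are the series of disjoint classes, indexed by the difference `l` of the extents;
convergence comes from the finiteness of each area. -/
theorem hasSum_termR1 (h : ℕ+) : HasSum (fun l : ℕ+ => termR1 h l)
    (genSeries {P | IsSymmetricConvex P ∧ extent northEast P = h ∧ (h : ℕ) < extent north P}
      Finset.card halfPerimeter) := by
  have e : (fun l : ℕ+ => termR1 h l) = fun l : ℕ+ =>
      genSeries (symmetricWithExtents h l) Finset.card halfPerimeter :=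
    funext fun l => termR1_eq h.pos l.pos
  rw [e]
  refine hasSum_genSeries _ _ (finite_sep_isSymmetricConvex fun P hP => hP.1) ?_ ?_
  · ext P
    simp only [Set.mem_iUnion]
    constructor
    · rintro ⟨hP, h1, h2⟩
      refine ⟨⟨extent north P - h, by omega⟩, hP, h1, ?_⟩
      rw [PNat.mk_coe]
      omega
    · rintro ⟨l, hP, h1, h2⟩
      have := l.pos
      exact ⟨hP, h1, by omega⟩
  · intro l l' hne
    refine Set.disjoint_left.mpr fun P h1 h2 => hne (PNat.coe_injective ?_)
    have e1 := h1.2.2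
    have e2 := h2.2.2
    omega

theorem hasSum_tsum_termR1 : HasSum (fun h : ℕ+ => ∑' l : ℕ+, termR1 h l)
    (genSeries {P | IsSymmetricConvex P ∧ extent north P > extent northEast P}
      Finset.card halfPerimeter) := by
  have e : (fun h : ℕ+ => ∑' l : ℕ+, termR1 h l) = fun h : ℕ+ => genSeries
      {P | IsSymmetricConvex P ∧ extent northEast P = h ∧ (h : ℕ) < extent north P}
      Finset.card halfPerimeter :=
    funext fun h => (hasSum_termR1 h).tsum_eq
  rw [e]
  refine hasSum_genSeries _ _ (finite_sep_isSymmetricConvex fun P hP => hP.1) ?_ ?_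
  · ext P
    simp only [Set.mem_iUnion]
    constructor
    · rintro ⟨hP, h1⟩
      exact ⟨⟨extent northEast P, hP.extent_northEast_pos⟩, hP, rfl, h1⟩
    · rintro ⟨h, hP, h1, h2⟩
      exact ⟨hP, h1 ▸ h2⟩
  · intro h h' hne
    refine Set.disjoint_left.mpr fun P h1 h2 => hne (PNat.coe_injective ?_)
    exact h1.2.1.symm.trans h2.2.1

theorem hasSum_termR3 : HasSum (fun h : ℕ+ => termR3 h)
    (genSeries {P | IsSymmetricConvex P ∧ extent north P = extent northEast P}
      Finset.card halfPerimeter) := by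
  have e : (fun h : ℕ+ => termR3 h) = fun h : ℕ+ =>
      genSeries (symmetricWithExtents h 0) Finset.card halfPerimeter :=
    funext fun h => termR3_eq h.pos
  rw [e]
  refine hasSum_genSeries _ _ (finite_sep_isSymmetricConvex fun P hP => hP.1) ?_ ?_
  · ext P
    simp only [Set.mem_iUnion]
    constructor
    · rintro ⟨hP, h1⟩
      exact ⟨⟨extent northEast P, hP.extent_northEast_pos⟩, hP, rfl, h1⟩
    · rintro ⟨h, hP, h1, h2⟩
      exact ⟨hP, h2.trans h1.symm⟩
  · intro h h' hne
    refine Set.disjoint_left.mpr fun P h1 h2 => hne (PNat.coe_injective ?_)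
    exact h1.2.1.symm.trans h2.2.1

theorem genSeries_extent_gt :
    genSeries {P | IsSymmetricConvex P ∧ extent north P > extent northEast P}
      Finset.card halfPerimeter = seriesR1 :=
  hasSum_tsum_termR1.tsum_eq.symm

theorem genSeries_extent_lt :
    genSeries {P | IsSymmetricConvex P ∧ extent north P < extent northEast P}
      Finset.card halfPerimeter = seriesR1 := by
  rw [genSeries_eq_of_bijOn bijOn_swapCells, ← genSeries_extent_gt]
  exact genSeries_congr (fun P _ => Finset.card_map _) (fun P hP => hP.1.halfPerimeter_swapCells)

theorem genSeries_extent_eq :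
    genSeries {P | IsSymmetricConvex P ∧ extent north P = extent northEast P}
      Finset.card halfPerimeter = seriesR3 :=
  hasSum_termR3.tsum_eq.symm

theorem genSeries_isSymmetricConvex :
    genSeries {P | IsSymmetricConvex P} Finset.card halfPerimeter = 2 * seriesR1 + seriesR3 := by
  -- Indexing the trichotomy of the extents by the finite type `Ordering` turns the sum over blocks
  -- into three terms.
  let T : Ordering → Set (Finset Cell) := fun o =>
    {P | IsSymmetricConvex P ∧ compare (extent north P) (extent northEast P) = o}
  have hsum := hasSum_genSeries (S := {P | IsSymmetricConvex P}) (T := T) Finset.card halfPerimeter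
    finite_isSymmetricConvex_card (by
      ext P
      simp [T]) (by
      intro o o' hne
      exact Set.disjoint_left.mpr fun P h1 h2 => hne (h1.2.symm.trans h2.2))
  have hfin := hsum.unique (hasSum_fintype _)
  have huniv : (Finset.univ : Finset Ordering) = {.lt, .eq, .gt} := rfl
  rw [hfin, huniv, Finset.sum_insert (by decide), Finset.sum_insert (by decide),
    Finset.sum_singleton]
  simp only [T, compare_lt_iff_lt, compare_eq_iff_eq, compare_gt_iff_gt]
  rw [genSeries_extent_lt, genSeries_extent_eq, genSeries_extent_gt]
  ring

end Convergence

open scoped MvPowerSeries.WithPiTopology in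
theorem mainTheorem6 :
    -- an invariant convex polyomino has a cell, and only one, as centre of symmetry
    (∀ P : Finset Cell, IsConvexPolyomino P →
      TransClass.mk P ∈ fixClasses groupH31 →
      ∃! c : Cell, c ∈ P ∧
        ∀ g ∈ groupH31, shift c (transform g (shift (-c) P)) = P) ∧
    -- the quotients by monomials in the definition of `R₁` are exact
    (∀ i r l : ℕ, i < 2 → 1 ≤ r → 1 ≤ l → tVar ^ (2 * r + l - 1) ∣ seriesDC i r l) ∧
    (∀ r l : ℕ, 1 ≤ r → 1 ≤ l → qVar ^ (3 * l) ∣ seriesDC01 r l) ∧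
    -- the sums in the definitions of `R₁` and `R₃` converge
    (∀ h : ℕ+, Summable fun l : ℕ+ => termR1 h l) ∧
    (Summable fun h : ℕ+ => ∑' l : ℕ+, termR1 h l) ∧
    (Summable fun h : ℕ+ => termR3 h) ∧
    -- there are finitely many convex polyominoes of given area, up to translation
    (∀ m : ℕ, {s ∈ convexClasses | s.area = m}.Finite) ∧
    -- the series of the three subclasses `h₁ > h₂`, `h₁ < h₂` and `h₁ = h₂`
    genSeries (fixH31Subclass fun h₁ h₂ => h₁ > h₂) TransClass.area TransClass.halfPerim
      = seriesR1 ∧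
    genSeries (fixH31Subclass fun h₁ h₂ => h₁ < h₂) TransClass.area TransClass.halfPerim
      = seriesR1 ∧
    genSeries (fixH31Subclass fun h₁ h₂ => h₁ = h₂) TransClass.area TransClass.halfPerim
      = seriesR3 ∧
    -- the series of `Fix(H_{3,1})`
    genSeries (fixClasses groupH31) TransClass.area TransClass.halfPerim
      = 2 * seriesR1 + seriesR3 := by

  refine ⟨fun P hP hfix => existsUnique_centre hP hfix,
    fun i r l hi hr _ => tVar_pow_dvd_seriesDC hi hr, fun r l hr _ => qVar_pow_dvd_seriesDC01 hr,
    fun h => (hasSum_termR1 h).summable, hasSum_tsum_termR1.summable, hasSum_termR3.summable,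
    finite_convexClasses_area, ?_, ?_, ?_, ?_⟩
  · rw [genSeries_fixH31Subclass, genSeries_extent_gt]
  · rw [genSeries_fixH31Subclass, genSeries_extent_lt]
  · rw [genSeries_fixH31Subclass, genSeries_extent_eq]
  · rw [genSeries_fixClasses, genSeries_isSymmetricConvex]
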